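/- For a real number $a$ and real letters $k_1,\dots,k_n$ let $$\mathrm{Hlog}(a,[k_1,\dots,k_n])=\int_0^a\frac{dx_1}{x_1-k_1}\int_0^{x_1}\frac{dx_2}{x_2-k_2}\cdots\int_0^{x_{n-1}}\frac{dx_n}{x_n-k_n},\qquad \mathrm{Hlog}(a,[\,])=1,$$ with the convention $\mathrm{Hlog}(a,[0,\dots,0])=\log(a)^n/n!$ for $n$ zeros. Let ${}_2F_1(a,b;c;z)$, $z<1$, denote the analytic continuation to $(-\infty,1)$ of Gauss' hypergeometric series. Let $\lambda\in\mathbb R$ with $|\lambda|\le\frac1\pi$, put $\alpha=\frac{\arcsin(\lambda\pi)}{\pi}$ and $c_\lambda=\frac{\lambda}{\alpha(1-\alpha)}$, where $\frac{\alpha}{\lambda}=\frac{\arcsin(\lambda\pi)}{\lambda\pi}$ and $c_\lambda$ are read as $1$ at $\lambda=0$, and define $$f(x)=\sum_{n=0}^\infty \mathrm{Hlog}(x,[\underbrace{0,-1,\dots,0,-1}_{n\text{ pairs}}])\,\alpha^{2n},\qquad g(x)=\sum_{n=0}^\infty \mathrm{Hlog}(x,[-1,\underbrace{0,-1,\dots,0,-1}_{n\text{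 pairs}}])\,\alpha^{2n}.$$ 1. For every $x>-1$ both series converge absolutely, and $$f(x)={}_2F_1(\alpha,-\alpha;1;-x),\qquad g(x)=x\;{}_2F_1(1+\alpha,1-\alpha;2;-x).$$ 2. Let in addition $\lambda>-\frac1\pi$. A real constant $c$ and a function $\phi$ on $[0,\infty)$, $\phi\in L^2(\mathbb R_+)$, satisfy $$\phi(x)=\frac{c}{1+x}-\lambda\int_0^\infty\frac{\phi(t)\,dt}{1+t+x}\quad(x\ge 0),\qquad \phi(0)=1,$$ if and only if $c=c_\lambda$, $\phi(0)=1$ and, for all $x>0$, $$\phi(x)=\frac{c_\lambda}{1+x}\,\frac{\arcsin(\lambda\pi)}{\lambda\pi}\,f(x)-\frac{\lambda c_\lambda}{x}\Big(\frac{\arcsin(\lambda\pi)}{\lambda\pi}\Big)^2 g(x).$$ Moreover, for $x>0$ the right hand side equals ${}_2F_1(1+\alpha,2-\alpha;2;-x)$. 3. Let $-\frac1\pi<\lambda\le\frac1\pi$ and $\mu>0$. A function $J$ on $[0,\infty)$ with $\frac{J(x)}{x(\mu^2+x)}\in L^2(\mathbb R_+)$ satisfies $$J(x)=x-\lambda x^2\int_0^\infty\frac{J(t)\,dt}{(t+\mu^2)^2(t+\mu^2+x)}\qquad(x\ge0)$$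 if and only if $J(x)=x\;{}_2F_1\big(\alpha,1-\alpha;2;-\tfrac{x}{\mu^2}\big)$ for all $x\ge 0$. For $x>0$ this function equals $x\big(1+\frac{x}{\mu^2}\big)\phi\big(\frac{x}{\mu^2}\big)$, with $\phi$ the combination of $f$ and $g$ in part 2. 4. Let $|\lambda|<\frac1\pi$, $\mu>0$, $x>0$, $u=x/\mu^2$. Let $b_{k,n}$ be the coefficient of $\lambda^k$ in the Taylor series of $\frac{\alpha^n}{1-\alpha}$ at $\lambda=0$, and put $$H_{2m}(u)=\mathrm{Hlog}(u,[\underbrace{0,-1,\dots,0,-1}_{m\text{ pairs}}]),\qquad H_{2m+1}(u)=-\frac{1+u}{u}\,\mathrm{Hlog}(u,[-1,\underbrace{0,-1,\dots,0,-1}_{m\text{ pairs}}]).$$ Then the solution $J$ of part 3 is the sum of the convergent power series $$J(x)=\sum_{k=0}^\infty\lambda^k\; x\sum_{n=0}^k b_{k,n}\,H_n(u).$$ -/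

import Mathlib

open Set MeasureTheory

/-- Hyperlogarithm `Hlog a [k₁, …, kₙ] = ∫₀^a dx₁/(x₁-k₁) ∫₀^{x₁} dx₂/(x₂-k₂) ⋯ ∫₀^{x_{n-1}} dxₙ/(xₙ-kₙ)`
with real letters, with `Hlog a [] = 1` and the usual regularisation
`Hlog a [0, …, 0] = log(a)^n / n!` of the divergent words consisting of zeros only. -/
noncomputable def Hlog : ℝ → List ℝ → ℝ
  | _, [] => 1
  | a, k :: ks =>
    if ∀ j ∈ k :: ks, j = 0 then
      Real.log a ^ (k :: ks).length / ((k :: ks).length.factorial : ℝ)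
    else ∫ x in (0 : ℝ)..a, Hlog x ks / (x - k)

/-- The word `[0, -1, …, 0, -1]`, with `n` times the pair `0, -1`. -/
def altWord (n : ℕ) : List ℝ := (List.replicate n [(0 : ℝ), -1]).flatten

/-- `F` is the analytic continuation to `(-∞, 1)` of Gauss' hypergeometric power series. -/
def IsGaussContinuation (a b c : ℝ) (F : ℝ → ℝ) : Prop :=
  AnalyticOnNhd ℝ F (Iio 1) ∧ ∀ z : ℝ, |z| < 1 → F z = ordinaryHypergeometric a b c z

open Classical in
/-- Gauss' hypergeometric function `₂F₁(a, b; c; z)` for real `z < 1`: the value at `z` of the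
analytic continuation to `(-∞, 1)` of the hypergeometric series, unique by the next lemma.
(Mathlib's `ordinaryHypergeometric` is only the sum of the series and is zero by convention where
the series diverges.) -/
noncomputable def gauss2F1 (a b c z : ℝ) : ℝ :=
  if h : ∃ F : ℝ → ℝ, IsGaussContinuation a b c F then h.choose z
  else ordinaryHypergeometric a b c z

theorem gauss2F1_eq {a b c : ℝ} {F : ℝ → ℝ} (hF : IsGaussContinuation a b c F) {z : ℝ}
    (hz : z < 1) : gauss2F1 a b c z = F z := by
  have h : ∃ F : ℝ → ℝ, IsGaussContinuation a b c F := ⟨F, hF⟩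
  have hc := h.choose_spec
  have key : EqOn h.choose F (Iio 1) := by
    refine hc.1.eqOn_of_preconnected_of_eventuallyEq hF.1 isPreconnected_Iio
      (z₀ := 0) (by simp) ?_
    have : Ioo (-1 : ℝ) 1 ∈ nhds (0 : ℝ) := Ioo_mem_nhds (by norm_num) (by norm_num)
    filter_upwards [this] with y hy
    have hy' : |y| < 1 := abs_lt.mpr hy
    rw [hc.2 y hy', hF.2 y hy']
  have hd : gauss2F1 a b c z = h.choose z := by
    unfold gauss2F1
    rw [dif_pos h]
  rw [hd]
  exact key hz

/-- `α = arcsin(λπ)/π`. -/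
noncomputable def alphaOf (l : ℝ) : ℝ := Real.arcsin (l * Real.pi) / Real.pi

/-- `f(x) = ∑ₙ Hlog(x, [0, -1, …, 0, -1]) α^{2n}` (`n` pairs of letters). -/
noncomputable def fHlog (l x : ℝ) : ℝ := ∑' n : ℕ, Hlog x (altWord n) * alphaOf l ^ (2 * n)

/-- `g(x) = ∑ₙ Hlog(x, [-1, 0, -1, …, 0, -1]) α^{2n}` (`n` pairs after the first letter). -/
noncomputable def gHlog (l x : ℝ) : ℝ :=
  ∑' n : ℕ, Hlog x (-1 :: altWord n) * alphaOf l ^ (2 * n)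

/-- `arcsin(λπ)/(λπ) = α/λ`, with its limit `1` at `λ = 0`. -/
noncomputable def arcsinQuot (l : ℝ) : ℝ :=
  if l = 0 then 1 else Real.arcsin (l * Real.pi) / (l * Real.pi)

/-- `c_λ = λ/(α(1-α))`, with its limit `1` at `λ = 0`. -/
noncomputable def cOf (l : ℝ) : ℝ := if l = 0 then 1 else l / (alphaOf l * (1 - alphaOf l))

/-- `c_λ arcsin(λπ)/(λπ) f(x)/(1+x) - λ c_λ (arcsin(λπ)/(λπ))² g(x)/x`, for `x > 0`. -/
noncomputable def phiHlog (l x : ℝ) : ℝ :=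
  cOf l * arcsinQuot l / (1 + x) * fHlog l x - l * cOf l * arcsinQuot l ^ 2 / x * gHlog l x

/-- `φ ∈ L²(ℝ₊)` solves the rescaled, symmetrised Fredholm equation with constant `c`:
`φ(x) = c/(1+x) - λ ∫₀^∞ φ(t)/(1+t+x) dt` for all `x ≥ 0`, normalised by `φ(0) = 1`. -/
def IsPhiSolution (l c : ℝ) (φ : ℝ → ℝ) : Prop :=
  MemLp φ 2 (volume.restrict (Ioi 0)) ∧ φ 0 = 1 ∧
    ∀ x : ℝ, 0 ≤ x → φ x = c / (1 + x) - l * ∫ t in Ioi (0 : ℝ), φ t / (1 + t + x)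

/-- `J` solves the Fredholm equation
`J(x) = x - λ x² ∫₀^∞ J(t)/((t+μ²)²(t+μ²+x)) dt` for all `x ≥ 0`,
in the class of functions for which `J(x)/(x(μ²+x))` belongs to `L²(ℝ₊)`. -/
def IsFredholmSolution (l μ : ℝ) (J : ℝ → ℝ) : Prop :=
  MemLp (fun x => J x / (x * (μ ^ 2 + x))) 2 (volume.restrict (Ioi 0)) ∧
    ∀ x : ℝ, 0 ≤ x →
      J x = x - l * x ^ 2 * ∫ t in Ioi (0 : ℝ), J t / ((t + μ ^ 2) ^ 2 * (t + μ ^ 2 + x))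

/-- The coefficient of `λ^k` in the Taylor series at `λ = 0` of `α^n/(1-α)`, `α = arcsin(λπ)/π`. -/
noncomputable def alphaTaylor (k n : ℕ) : ℝ :=
  iteratedDeriv k (fun l : ℝ => alphaOf l ^ n / (1 - alphaOf l)) 0 / (k.factorial : ℝ)

/-- The hyperlogarithm that goes with `α^n` in the expansion of `J`: for even `n = 2m` it is
`Hlog(u, [0,-1,…,0,-1])`, and for odd `n = 2m+1` it is `-((1+u)/u) Hlog(u, [-1,0,-1,…,0,-1])`,
with `n` letters in both cases (for `u > 0`). -/
noncomputable def letterTerm (u : ℝ) (n : ℕ) : ℝ :=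
  if Even n then Hlog u (altWord (n / 2))
  else -((1 + u) / u) * Hlog u (-1 :: altWord (n / 2))

/-- The coefficient of `λ^k` in the expansion of `J(x)`, a combination of hyperlogarithms of
`x/μ²` with at most `k` letters. -/
noncomputable def JCoeff (μ x : ℝ) (k : ℕ) : ℝ :=
  x * ∑ n ∈ Finset.range (k + 1), alphaTaylor k n * letterTerm (x / μ ^ 2) n

/-! Existence. Let Φ(x) = ₂F₁(2-α, 1+α; 2; -x) (`gaussPhi`), with coefficients (-1)^n u_n. The
Stieltjes integral ∫ Φ(t)/(1+t+x) dt has Taylor coefficients (-1)^n m_n at 0, where m_n = ∫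
Φ(t)(1+t)^(-n-1) dt. The hypergeometric equation for Φ and an integration by parts give a recurrence
for m_n (`phiMoment_succ`) whose homogeneous part is the recurrence of u_n. The limit L of u_n
satisfies L α(1-α) = sin(πα)/π = λ by the reflection formula, so L = c_λ and u_n + λ m_n - L is a
constant multiple of u_n. It tends to 0 while u_n tends to L > 0, hence it vanishes (`phiCoeff_eq`).
Summation gives the equation near 0, and analyticity carries it to x > -1 (`gaussPhi_equation`).

Uniqueness. The kernel 1/(1+t+x) obeys Schur's test on L²(0,∞) with weight t^(-1/2) and constant π
√(x/(1+x)), strictly below π at every x. So the homogeneous equation has only the zero solution,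
even for |λ| = 1/π (`ae_eq_zero_of_stieltjes_eq`). The equation for J becomes the one for φ after
scaling by μ² and a partial fraction decomposition; Euler's transformation turns (1+x)Φ into ₂F₁(α,
1-α; 2; -x).

Hyperlogarithms. F = ₂F₁(α, -α; 1; -x) and xG, with G = ₂F₁(1+α, 1-α; 2; -x), satisfy F' = α² G and
(xG)' = F/(1+x). Integrating these in turn adds the letters 0 and -1, with remainders of order
1/(N!)² (`hasSum_Hlog`).

Expansion in λ. The Taylor coefficients of α in λ are nonnegative, so absolute convergence at |λ|
allows the double series in powers of α and λ to be rearranged (`hasSum_rearrange`). -/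

open Filter Topology

/-! ### Functions given by power series on an interval. -/

/-- `p` sums to `F` on the interval `|x| < r`. -/
def PowerSum (p : PowerSeries ℝ) (F : ℝ → ℝ) (r : ℝ) : Prop :=
  ∀ x : ℝ, |x| < r → HasSum (fun n => p.coeff n * x ^ n) (F x)

namespace PowerSum

variable {p q : PowerSeries ℝ} {F G : ℝ → ℝ} {r s : ℝ}

theorem mono (h : PowerSum p F r) (hs : s ≤ r) : PowerSum p F s :=
  fun x hx => h x (hx.trans_le hs)

theorem congr (h : PowerSum p F r) (hFG : ∀ x, |x| < r → F x = G x) : PowerSum p G r :=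
  fun x hx => hFG x hx ▸ h x hx

theorem add (hF : PowerSum p F r) (hG : PowerSum q G r) :
    PowerSum (p + q) (fun x => F x + G x) r := fun x hx => by
  simpa [add_mul] using (hF x hx).add (hG x hx)

theorem const (c r : ℝ) : PowerSum (PowerSeries.C c) (fun _ => c) r := fun x _ => by
  convert! hasSum_single (f := fun n => (PowerSeries.C c).coeff n * x ^ n) 0 ?_ using 1
  · simp
  · intro n hn
    simp [PowerSeries.coeff_C, hn]

theorem id (r : ℝ) : PowerSum PowerSeries.X (fun x => x) r := fun x _ => by
  convert! hasSum_single (f := fun n => (PowerSeries.X : PowerSeries ℝ).coeff n * x ^ n) 1 ?_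
    using 1
  · simp
  · intro n hn
    simp [PowerSeries.coeff_X, hn]

theorem summable_norm (hF : PowerSum p F r) {x : ℝ} (hx : |x| < r) :
    Summable (fun n => ‖p.coeff n * x ^ n‖) := (hF x hx).summable.norm

theorem mul (hF : PowerSum p F r) (hG : PowerSum q G r) :
    PowerSum (p * q) (fun x => F x * G x) r := fun x hx => by
  have h1 := hF.summable_norm hx
  have h2 := hG.summable_norm hx
  have h3 := tsum_mul_tsum_eq_tsum_sum_antidiagonal_of_summable_norm h1 h2
  rw [(hF x hx).tsum_eq, (hG x hx).tsum_eq] at h3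
  have h4 := (summable_norm_sum_mul_antidiagonal_of_summable_norm h1 h2).of_norm
  have h5 := h4.hasSum
  rw [← h3] at h5
  convert! h5 using 2 with n
  rw [PowerSeries.coeff_mul, Finset.sum_mul]
  refine Finset.sum_congr rfl fun kl hkl => ?_
  rw [← Finset.HasAntidiagonal.mem_antidiagonal.mp hkl, pow_add]
  ring

theorem pow (hF : PowerSum p F r) (n : ℕ) : PowerSum (p ^ n) (fun x => F x ^ n) r := by
  induction n with
  | zero => simpa using const 1 r
  | succ n ih => simpa [pow_succ] using ih.mul hF

theorem const_mul (c : ℝ) (hF : PowerSum p F r) :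
    PowerSum (PowerSeries.C c * p) (fun x => c * F x) r := (const c r).mul hF

theorem hasFPowerSeriesAt {z : ℝ} (h : PowerSum p (fun x => F (z + x)) r) (hr : 0 < r) :
    HasFPowerSeriesAt F (FormalMultilinearSeries.ofScalars ℝ (fun n => p.coeff n)) z := by
  rw [hasFPowerSeriesAt_iff]
  filter_upwards [Metric.ball_mem_nhds (0 : ℝ) hr] with x hx
  have := h x (by simpa using hx)
  simpa [FormalMultilinearSeries.coeff_ofScalars, mul_comm] using this

theorem analyticAt {z : ℝ} (h : PowerSum p (fun x => F (z + x)) r) (hr : 0 < r) :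
    AnalyticAt ℝ F z := (h.hasFPowerSeriesAt hr).analyticAt

theorem coeff_eq (h : PowerSum p F r) (hr : 0 < r) (n : ℕ) :
    p.coeff n = iteratedDeriv n F 0 / (n.factorial : ℝ) := by
  have h0 : PowerSum p (fun x => F (0 + x)) r := by simpa using h
  have h1 := h0.hasFPowerSeriesAt hr
  have h2 := (h0.analyticAt hr).hasFPowerSeriesAt
  have h3 := h1.eq_formalMultilinearSeries h2
  have := congrArg (fun s => FormalMultilinearSeries.coeff s n) h3
  simpa [FormalMultilinearSeries.coeff_ofScalars] using this

theorem eventually_eq (hF : PowerSum p F r) (hG : PowerSum p G s) (hr : 0 < r) (hs : 0 < s) :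
    F =ᶠ[𝓝 0] G := by
  filter_upwards [Metric.ball_mem_nhds (0 : ℝ) hr, Metric.ball_mem_nhds (0 : ℝ) hs] with x h1 h2
  exact (hF x (by simpa using h1)).unique (hG x (by simpa using h2))

/-- Some positive radius is enough: identities are compared near 0 and then continued analytically.
-/
theorem exists_deriv (h : PowerSum p F r) (hr : 0 < r) :
    ∃ s > 0, PowerSum (PowerSeries.mk fun n => p.coeff (n + 1) * (n + 1)) (deriv F) s := by
  have h0 : PowerSum p (fun x => F (0 + x)) r := by simpa using h
  have h2 := (h0.analyticAt hr).deriv.hasFPowerSeriesAt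
  rw [hasFPowerSeriesAt_iff] at h2
  obtain ⟨s, hs, h3⟩ := Metric.eventually_nhds_iff_ball.mp h2
  refine ⟨s, hs, fun x hx => ?_⟩
  have := h3 x (by simpa using hx)
  rw [zero_add] at this
  convert! this using 2 with n
  rw [PowerSeries.coeff_mk, h.coeff_eq hr, FormalMultilinearSeries.coeff_ofScalars,
    ← iteratedDeriv_succ', Nat.factorial_succ]
  push_cast
  field_simp
  have hn : (n.factorial : ℝ) ≠ 0 := by positivity
  simp only [smul_eq_mul]
  field_simp

end PowerSum

/-! ### Binomial series and Euler's integral. -/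

/-- The coefficients of `(1 - x) ^ (-a)`. -/
noncomputable def negBinomCoeff (a : ℝ) (n : ℕ) : ℝ :=
  (ascPochhammer ℝ n).eval a / (n.factorial : ℝ)

theorem powerSum_one_sub_rpow_neg (a : ℝ) :
    PowerSum (PowerSeries.mk (negBinomCoeff a)) (fun x => (1 - x) ^ (-a)) 1 := fun x hx => by
  have h := (Real.one_add_rpow_hasFPowerSeriesOnBall_zero (a := -a)).hasSum (y := -x)
    (by simpa [← ofReal_norm] using hx)
  -- The parameter `b` stands both above and below and cancels; 1 is a choice that avoids the poles.
  rw [binomialSeries_eq_ordinaryHypergeometricSeries (b := (1 : ℝ))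
    (by intro k; have : (0 : ℝ) ≤ k := k.cast_nonneg; intro h; linarith)] at h
  convert! h using 1
  · funext n
    simp only [neg_neg, FormalMultilinearSeries.compContinuousLinearMap_apply]
    rw [show ((⇑(-ContinuousLinearMap.id ℝ ℝ) : ℝ → ℝ) ∘ fun _ : Fin n => -x) = fun _ => x by
      funext i; simp, ordinaryHypergeometricSeries_apply_eq]
    have : (Polynomial.eval (1 : ℝ) (ascPochhammer ℝ n)) ≠ 0 := by
      rw [ascPochhammer_eval_one]; positivity
    simp only [PowerSeries.coeff_mk, negBinomCoeff, smul_eq_mul]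
    field_simp
  · simp [sub_eq_add_neg]

/-- Integrals of `w (1 - h u)^(-a)` are power series in `h`. -/
theorem powerSum_integral_binomial {X : Type*} [MeasurableSpace X] {μ : Measure X} {w u : X → ℝ}
    (hw : Integrable w μ) (hu : AEStronglyMeasurable u μ) {R : ℝ} (hR : 0 < R)
    (hb : ∀ᵐ s ∂μ, |u s| ≤ R) (a : ℝ) :
    PowerSum (PowerSeries.mk fun n => negBinomCoeff a n * ∫ s, w s * u s ^ n ∂μ)
      (fun h => ∫ s, w s * (1 - h * u s) ^ (-a) ∂μ) R⁻¹ := fun h hh => by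
  have hRh : |R * (|h|)| < 1 := by
    rw [abs_mul, abs_abs, abs_of_pos hR]
    calc R * |h| < R * R⁻¹ := by gcongr
      _ = 1 := mul_inv_cancel₀ hR.ne'
  have hint : ∀ n : ℕ, Integrable (fun s => w s * u s ^ n) μ := fun n => by
    refine hw.mul_bdd (c := R ^ n) (hu.pow n) ?_
    filter_upwards [hb] with s hs
    rw [norm_pow]
    exact pow_le_pow_left₀ (norm_nonneg _) hs n
  have hI : ∀ n : ℕ, Integrable (fun s => negBinomCoeff a n * (w s * u s ^ n) * h ^ n) μ :=
    fun n => ((hint n).const_mul _).mul_const _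
  have key := hasSum_integral_of_summable_integral_norm hI ?_
  · convert! key using 1
    · funext n
      rw [integral_mul_const, integral_const_mul, PowerSeries.coeff_mk]
    · refine integral_congr_ae ?_
      filter_upwards [hb] with s hs
      have h1 : |h * u s| < 1 := by
        rw [abs_mul]
        rw [abs_mul, abs_abs, abs_of_pos hR] at hRh
        calc |h| * |u s| ≤ |h| * R := by gcongr
          _ < 1 := by rwa [mul_comm]
      have h2 := (powerSum_one_sub_rpow_neg a (h * u s) h1).mul_left (w s)
      rw [← h2.tsum_eq]
      refine tsum_congr fun n => ?_
      rw [PowerSeries.coeff_mk]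
      ring
  -- Bounding |u|^n by R^n leaves the binomial series at R|h| < 1, which converges absolutely.
  · have h1 := ((powerSum_one_sub_rpow_neg a).summable_norm hRh).mul_right (∫ s, ‖w s‖ ∂μ)
    refine Summable.of_nonneg_of_le (fun n => by positivity) (fun n => ?_) h1
    rw [← integral_const_mul]
    refine integral_mono_ae (hI n).norm (hw.norm.const_mul _) ?_
    filter_upwards [hb] with s hs
    simp only [norm_mul, norm_pow, PowerSeries.coeff_mk, Real.norm_eq_abs, abs_abs, mul_pow,
      abs_of_pos hR]
    calc |negBinomCoeff a n| * (|w s| * |u s| ^ n) * |h| ^ n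
        ≤ |negBinomCoeff a n| * (|w s| * R ^ n) * |h| ^ n := by gcongr
      _ = _ := by ring

theorem ascPochhammer_eval_succ_left (n : ℕ) (k : ℝ) :
    (ascPochhammer ℝ (n + 1)).eval k = k * (ascPochhammer ℝ n).eval (k + 1) := by
  rw [ascPochhammer_succ_left, Polynomial.eval_mul, Polynomial.eval_X, Polynomial.eval_comp]
  simp

open ProbabilityTheory in
theorem integrable_betaPDFReal {b d : ℝ} (hb : 0 < b) (hd : 0 < d) :
    Integrable (betaPDFReal b d) := by
  refine ⟨(stronglyMeasurable_betaPDFReal b d).aestronglyMeasurable, ?_⟩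
  rw [hasFiniteIntegral_iff_ofReal]
  · have := lintegral_betaPDF_eq_one hb hd
    simp only [betaPDF] at this
    rw [this]; simp
  · refine ae_of_all _ fun s => ?_
    by_cases hs : 0 < s ∧ s < 1
    · exact (betaPDFReal_pos hs.1 hs.2 hb hd).le
    · simp [betaPDFReal, hs]

open ProbabilityTheory in
theorem betaPDFReal_nonneg {b d : ℝ} (hb : 0 < b) (hd : 0 < d) (s : ℝ) :
    0 ≤ betaPDFReal b d s := by
  by_cases hs : 0 < s ∧ s < 1
  · exact (betaPDFReal_pos hs.1 hs.2 hb hd).le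
  · simp [betaPDFReal, hs]

open ProbabilityTheory in
theorem setIntegral_betaPDFReal {b d : ℝ} (hb : 0 < b) (hd : 0 < d) :
    ∫ s in Ioo (0 : ℝ) 1, betaPDFReal b d s = 1 := by
  rw [setIntegral_eq_integral_of_forall_compl_eq_zero]
  · rw [integral_eq_lintegral_of_nonneg_ae (ae_of_all _ (betaPDFReal_nonneg hb hd))
      (stronglyMeasurable_betaPDFReal b d).aestronglyMeasurable]
    have := lintegral_betaPDF_eq_one hb hd
    simp only [betaPDF] at this
    rw [this]; simp
  · intro s hs
    exact if_neg hs

open ProbabilityTheory in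
theorem betaPDFReal_mul_self {b d s : ℝ} (hb : 0 < b) (hd : 0 < d) (hs : s ∈ Ioo (0 : ℝ) 1) :
    betaPDFReal b d s * s = b / (b + d) * betaPDFReal (b + 1) d s := by
  have h1 : 0 < s ∧ s < 1 := hs
  simp only [betaPDFReal, h1, and_self, if_true, beta]
  rw [Real.Gamma_add_one hb.ne', show b + 1 + d = b + d + 1 by ring,
    Real.Gamma_add_one (by positivity), show b + 1 - 1 = b - 1 + 1 by ring,
    Real.rpow_add_one hs.1.ne']
  have := Real.Gamma_pos_of_pos hb
  have := Real.Gamma_pos_of_pos hd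
  have := Real.Gamma_pos_of_pos (add_pos hb hd)
  field_simp

open ProbabilityTheory in
theorem setIntegral_betaPDFReal_mul_pow {b d : ℝ} (hb : 0 < b) (hd : 0 < d) (n : ℕ) :
    ∫ s in Ioo (0 : ℝ) 1, betaPDFReal b d s * s ^ n =
      (ascPochhammer ℝ n).eval b / (ascPochhammer ℝ n).eval (b + d) := by
  induction n generalizing b with
  | zero => simpa using setIntegral_betaPDFReal hb hd
  | succ n ih =>
    rw [ascPochhammer_eval_succ_left, ascPochhammer_eval_succ_left]
    have h : ∫ s in Ioo (0 : ℝ) 1, betaPDFReal b d s * s ^ (n + 1) =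
        ∫ s in Ioo (0 : ℝ) 1, b / (b + d) * (betaPDFReal (b + 1) d s * s ^ n) := by
      refine setIntegral_congr_fun measurableSet_Ioo fun s hs => ?_
      rw [pow_succ', ← mul_assoc, betaPDFReal_mul_self hb hd hs, mul_assoc]
    rw [h, integral_const_mul, ih (by positivity), show b + 1 + d = b + d + 1 by ring,
      div_mul_div_comm]

/-- Euler's integral, normalised at `x = 0`. -/
noncomputable def eulerInt (a b d x : ℝ) : ℝ :=
  ∫ s in Ioo (0 : ℝ) 1, ProbabilityTheory.betaPDFReal b d s * (1 + x * s) ^ (-a)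

theorem one_add_mul_pos {x s : ℝ} (hx : -1 < x) (hs : s ∈ Icc (0 : ℝ) 1) : 0 < 1 + x * s := by
  rcases le_or_gt 0 x with h | h
  · have := mul_nonneg h hs.1; linarith
  · nlinarith [hs.2, hs.1]

theorem integrableOn_eulerInt {b d : ℝ} (hb : 0 < b) (hd : 0 < d) (a : ℝ) {x : ℝ} (hx : -1 < x) :
    IntegrableOn (fun s => ProbabilityTheory.betaPDFReal b d s * (1 + x * s) ^ (-a))
      (Ioo (0 : ℝ) 1) := by
  refine IntegrableOn.mono_set (t := Icc (0 : ℝ) 1) ?_ Ioo_subset_Icc_self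
  refine (integrable_betaPDFReal hb hd).integrableOn.mul_continuousOn ?_ isCompact_Icc
  refine ContinuousOn.rpow_const (by fun_prop) fun s hs => Or.inl (one_add_mul_pos hx hs).ne'

/-- Factor 1 + (x+h)s = (1 + xs)(1 + h s/(1+xs)). Since s/(1+xs) ≤ 1/(1+x) on (0,1), the expansion
in h is valid up to the distance 1 + x from the singularity at -1. -/
theorem powerSum_eulerInt_add {b d : ℝ} (hb : 0 < b) (hd : 0 < d) (a : ℝ) {x : ℝ} (hx : -1 < x) :
    PowerSum (PowerSeries.mk fun n => negBinomCoeff a n *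
        ∫ s in Ioo (0 : ℝ) 1, ProbabilityTheory.betaPDFReal b d s * (1 + x * s) ^ (-a) *
          (-(s / (1 + x * s))) ^ n)
      (fun h => eulerInt a b d (x + h)) (1 + x) := by
  have h1x : 0 < 1 + x := by linarith
  have hmeas : AEStronglyMeasurable (fun s : ℝ => -(s / (1 + x * s)))
      (volume.restrict (Ioo (0 : ℝ) 1)) := by
    refine Measurable.aestronglyMeasurable ?_
    fun_prop
  have hbound : ∀ᵐ s ∂(volume.restrict (Ioo (0 : ℝ) 1)), |(-(s / (1 + x * s)))| ≤ (1 + x)⁻¹ := by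
    filter_upwards [ae_restrict_mem measurableSet_Ioo] with s hs
    have h2 := one_add_mul_pos hx (Ioo_subset_Icc_self hs)
    rw [abs_neg, abs_of_nonneg (div_nonneg hs.1.le h2.le), div_le_iff₀ h2, inv_mul_eq_div,
      le_div_iff₀ h1x]
    nlinarith [hs.2]
  have key := powerSum_integral_binomial (integrableOn_eulerInt hb hd a hx) hmeas
    (inv_pos.mpr h1x) hbound a
  rw [inv_inv] at key
  refine key.congr fun h hh => ?_
  refine setIntegral_congr_fun measurableSet_Ioo fun s hs => ?_
  have h2 := one_add_mul_pos hx (Ioo_subset_Icc_self hs)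
  have h3 := one_add_mul_pos (show -1 < x + h by linarith [(abs_lt.mp hh).1])
    (Ioo_subset_Icc_self hs)
  have h4 : 1 + (x + h) * s = (1 + x * s) * (1 - h * (-(s / (1 + x * s)))) := by
    field_simp; ring
  have h5 : 0 ≤ 1 - h * (-(s / (1 + x * s))) := by
    by_contra! h6
    nlinarith
  rw [h4, Real.mul_rpow h2.le h5, mul_assoc]

theorem analyticOnNhd_eulerInt {b d : ℝ} (hb : 0 < b) (hd : 0 < d) (a : ℝ) :
    AnalyticOnNhd ℝ (eulerInt a b d) (Ioi (-1)) := fun x hx =>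
  (powerSum_eulerInt_add hb hd a hx).analyticAt (by have : -1 < x := hx; linarith)

/-- The power series of `x ↦ ₂F₁(a, b; c; -x)`. -/
noncomputable def gaussSeries (a b c : ℝ) : PowerSeries ℝ :=
  PowerSeries.mk fun n => (-1) ^ n * ordinaryHypergeometricCoefficient a b c n

theorem powerSum_eulerInt {b d : ℝ} (hb : 0 < b) (hd : 0 < d) (a : ℝ) :
    PowerSum (gaussSeries a b (b + d)) (eulerInt a b d) 1 := by
  have h := powerSum_eulerInt_add hb hd a (x := 0) (by norm_num)
  simp only [zero_mul, add_zero, zero_add, Real.one_rpow, mul_one, div_one] at h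
  convert! h using 1
  ext n
  have : ∀ s : ℝ, ProbabilityTheory.betaPDFReal b d s * (-s) ^ n =
      (-1) ^ n * (ProbabilityTheory.betaPDFReal b d s * s ^ n) := by
    intro s
    rw [neg_pow]
    ring
  simp only [gaussSeries, PowerSeries.coeff_mk, this]
  rw [integral_const_mul, setIntegral_betaPDFReal_mul_pow hb hd, negBinomCoeff,
    ordinaryHypergeometricCoefficient]
  ring

theorem gaussSeries_symm (a b c : ℝ) : gaussSeries a b c = gaussSeries b a c := by
  ext n
  simp only [gaussSeries, PowerSeries.coeff_mk, ordinaryHypergeometricCoefficient]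
  ring

theorem gauss2F1_neg_eq {a b c : ℝ} {F : ℝ → ℝ} (hF : AnalyticOnNhd ℝ F (Ioi (-1)))
    (hp : PowerSum (gaussSeries a b c) F 1) {x : ℝ} (hx : -1 < x) :
    gauss2F1 a b c (-x) = F x := by
  have h : IsGaussContinuation a b c (fun z => F (-z)) := by
    refine ⟨?_, fun z hz => ?_⟩
    · refine hF.comp (g := F) (f := fun z => -z) (analyticOnNhd_id.neg) ?_
      intro z hz
      simp only [mem_Iio, mem_Ioi] at hz ⊢
      linarith
    · have := (hp (-z) (by rwa [abs_neg])).tsum_eq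
      simp only
      rw [← this, ordinaryHypergeometric_eq_tsum]
      refine tsum_congr fun n => ?_
      rw [gaussSeries, PowerSeries.coeff_mk, ordinaryHypergeometricCoefficient, neg_pow z,
        smul_eq_mul]
      have : ((-1 : ℝ) ^ n) * (-1) ^ n = 1 := by rw [← mul_pow]; simp
      linear_combination ((n.factorial : ℝ)⁻¹ * (ascPochhammer ℝ n).eval a *
        (ascPochhammer ℝ n).eval b * ((ascPochhammer ℝ n).eval c)⁻¹ * z ^ n) * this
  rw [gauss2F1_eq h (by linarith), neg_neg]

/-- This turns identities between coefficients into identities on all of (-1, ∞). -/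
theorem eq_of_powerSum {F G : ℝ → ℝ} {p : PowerSeries ℝ} {r s : ℝ}
    (hF : AnalyticOnNhd ℝ F (Ioi (-1))) (hG : AnalyticOnNhd ℝ G (Ioi (-1)))
    (hr : 0 < r) (hs : 0 < s) (hpF : PowerSum p F r) (hpG : PowerSum p G s) {x : ℝ}
    (hx : -1 < x) : F x = G x :=
  hF.eqOn_of_preconnected_of_eventuallyEq hG isPreconnected_Ioi (z₀ := 0) (by simp)
    (hpF.eventually_eq hpG hr hs) hx

/-! ### The four hypergeometric functions and their contiguous relations. -/

/-- `x ↦ ₂F₁(1 - α, 1 + α; 2; -x)`. -/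
noncomputable def gaussG (α : ℝ) : ℝ → ℝ := eulerInt (1 - α) (1 + α) (1 - α)

/-- `x ↦ ₂F₁(2 - α, 1 + α; 2; -x)`. -/
noncomputable def gaussPhi (α : ℝ) : ℝ → ℝ := eulerInt (2 - α) (1 + α) (1 - α)

/-- `x ↦ ₂F₁(α, 1 - α; 2; -x)`. -/
noncomputable def gaussJ (α : ℝ) : ℝ → ℝ := eulerInt α (1 - α) (1 + α)

/-- `x ↦ ₂F₁(α, -α; 1; -x)`. -/
noncomputable def gaussF (α x : ℝ) : ℝ :=
  (1 - α) * gaussJ α x + α * ((1 + x) * gaussG α x)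

section

variable {α : ℝ}

theorem analyticOnNhd_gaussG (h1 : -1 < α) (h2 : α < 1) : AnalyticOnNhd ℝ (gaussG α) (Ioi (-1)) :=
  analyticOnNhd_eulerInt (by linarith) (by linarith) _

theorem analyticOnNhd_gaussPhi (h1 : -1 < α) (h2 : α < 1) :
    AnalyticOnNhd ℝ (gaussPhi α) (Ioi (-1)) :=
  analyticOnNhd_eulerInt (by linarith) (by linarith) _

theorem analyticOnNhd_gaussJ (h1 : -1 < α) (h2 : α < 1) : AnalyticOnNhd ℝ (gaussJ α) (Ioi (-1)) :=
  analyticOnNhd_eulerInt (by linarith) (by linarith) _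

theorem analyticOnNhd_gaussF (h1 : -1 < α) (h2 : α < 1) :
    AnalyticOnNhd ℝ (gaussF α) (Ioi (-1)) :=
  (analyticOnNhd_const.mul (analyticOnNhd_gaussJ h1 h2)).add (analyticOnNhd_const.mul
    ((analyticOnNhd_const.add analyticOnNhd_id).mul (analyticOnNhd_gaussG h1 h2)))

theorem powerSum_gaussG (h1 : -1 < α) (h2 : α < 1) :
    PowerSum (gaussSeries (1 - α) (1 + α) 2) (gaussG α) 1 := by
  have := powerSum_eulerInt (b := 1 + α) (d := 1 - α) (by linarith) (by linarith) (1 - α)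
  rwa [show 1 + α + (1 - α) = 2 by ring] at this

theorem powerSum_gaussPhi (h1 : -1 < α) (h2 : α < 1) :
    PowerSum (gaussSeries (2 - α) (1 + α) 2) (gaussPhi α) 1 := by
  have := powerSum_eulerInt (b := 1 + α) (d := 1 - α) (by linarith) (by linarith) (2 - α)
  rwa [show 1 + α + (1 - α) = 2 by ring] at this

theorem powerSum_gaussJ (h1 : -1 < α) (h2 : α < 1) :
    PowerSum (gaussSeries α (1 - α) 2) (gaussJ α) 1 := by
  have := powerSum_eulerInt (b := 1 - α) (d := 1 + α) (by linarith) (by linarith) α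
  rwa [show 1 - α + (1 + α) = 2 by ring] at this

theorem ascPochhammer_eval_two (n : ℕ) :
    (ascPochhammer ℝ n).eval 2 = (n.factorial : ℝ) * (n + 1) := by
  induction n with
  | zero => simp
  | succ n ih => rw [ascPochhammer_succ_eval, ih, Nat.factorial_succ]; push_cast; ring

/-- Euler's integral for ₂F₁(α, -α; 1) would need a positive second parameter, which depends on the
sign of α and fails at α = 0. This contiguous relation reduces it to two functions whose integrals
converge for all |α| < 1. -/
theorem gaussSeries_F_eq : gaussSeries α (-α) 1 =
    PowerSeries.C (1 - α) * gaussSeries α (1 - α) 2 +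
      PowerSeries.C α * ((1 + PowerSeries.X) * gaussSeries (1 - α) (1 + α) 2) := by
  ext n
  cases n with
  | zero =>
    simp [gaussSeries, ordinaryHypergeometricCoefficient, add_mul]
  | succ n =>
    have e1 := ascPochhammer_eval_succ_left n α
    have e2 := ascPochhammer_eval_succ_left n (-α)
    rw [add_comm α] at e1
    rw [show -α + 1 = 1 - α by ring] at e2
    simp only [gaussSeries, PowerSeries.coeff_mk, add_mul, one_mul, map_add,
      PowerSeries.coeff_C_mul, PowerSeries.coeff_succ_X_mul, ordinaryHypergeometricCoefficient,
      ascPochhammer_eval_two, ascPochhammer_eval_one, e1, e2]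
    simp only [ascPochhammer_succ_eval, Nat.factorial_succ]
    push_cast
    have : (n.factorial : ℝ) ≠ 0 := by positivity
    field_simp
    ring

/-- Euler's transformation, with exponent c - a - b = 1. -/
theorem gaussSeries_J_eq : gaussSeries α (1 - α) 2 =
    (1 + PowerSeries.X) * gaussSeries (2 - α) (1 + α) 2 := by
  ext n
  cases n with
  | zero =>
    simp [gaussSeries, ordinaryHypergeometricCoefficient, add_mul]
  | succ n =>
    have e1 := ascPochhammer_eval_succ_left n α
    have e2 := ascPochhammer_eval_succ_left n (1 - α)
    rw [add_comm α] at e1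
    rw [show 1 - α + 1 = 2 - α by ring] at e2
    simp only [gaussSeries, PowerSeries.coeff_mk, add_mul, one_mul, map_add,
      PowerSeries.coeff_succ_X_mul, ordinaryHypergeometricCoefficient,
      ascPochhammer_eval_two, e1, e2]
    simp only [ascPochhammer_succ_eval, Nat.factorial_succ]
    push_cast
    have : (n.factorial : ℝ) ≠ 0 := by positivity
    field_simp
    ring

theorem gaussSeries_deriv_F_eq :
    (PowerSeries.mk fun n => (gaussSeries α (-α) 1).coeff (n + 1) * (n + 1)) =
      PowerSeries.C (α ^ 2) * gaussSeries (1 - α) (1 + α) 2 := by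
  ext n
  have e1 := ascPochhammer_eval_succ_left n α
  have e2 := ascPochhammer_eval_succ_left n (-α)
  rw [add_comm α] at e1
  rw [show -α + 1 = 1 - α by ring] at e2
  simp only [gaussSeries, PowerSeries.coeff_mk,
    PowerSeries.coeff_C_mul, ordinaryHypergeometricCoefficient,
    ascPochhammer_eval_two, ascPochhammer_eval_one, e1, e2]
  simp only [Nat.factorial_succ]
  push_cast
  have : (n.factorial : ℝ) ≠ 0 := by positivity
  field_simp
  ring

/-- In terms of functions: F = (1+x)(xG)'. With F' = α² G this is the system behind the alternating
words. -/
theorem gaussSeries_deriv_G_eq : gaussSeries α (-α) 1 =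
    (1 + PowerSeries.X) * (gaussSeries (1 - α) (1 + α) 2 + PowerSeries.X *
      PowerSeries.mk fun n => (gaussSeries (1 - α) (1 + α) 2).coeff (n + 1) * (n + 1)) := by
  ext n
  cases n with
  | zero =>
    simp [gaussSeries, ordinaryHypergeometricCoefficient, add_mul]
  | succ n =>
    have e1 := ascPochhammer_eval_succ_left n α
    have e2 := ascPochhammer_eval_succ_left n (-α)
    rw [add_comm α] at e1
    rw [show -α + 1 = 1 - α by ring] at e2
    cases n with
    | zero =>
      simp [gaussSeries, ordinaryHypergeometricCoefficient, add_mul, PowerSeries.coeff_succ_X_mul]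
      ring
    | succ n =>
    simp only [gaussSeries, PowerSeries.coeff_mk, add_mul, mul_add, one_mul, map_add,
      PowerSeries.coeff_succ_X_mul, ordinaryHypergeometricCoefficient,
      ascPochhammer_eval_two, ascPochhammer_eval_one, e1, e2]
    simp only [ascPochhammer_succ_eval, Nat.factorial_succ]
    push_cast
    have : (n.factorial : ℝ) ≠ 0 := by positivity
    field_simp
    ring

theorem powerSum_one_add (r : ℝ) : PowerSum (1 + PowerSeries.X) (fun x => 1 + x) r := by
  simpa using (PowerSum.const 1 r).add (PowerSum.id r)

theorem powerSum_gaussF (h1 : -1 < α) (h2 : α < 1) :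
    PowerSum (gaussSeries α (-α) 1) (gaussF α) 1 := by
  rw [gaussSeries_F_eq]
  exact ((powerSum_gaussJ h1 h2).const_mul _).add
    (((powerSum_one_add 1).mul (powerSum_gaussG h1 h2)).const_mul _)

theorem one_add_mul_gaussPhi (h1 : -1 < α) (h2 : α < 1) {x : ℝ} (hx : -1 < x) :
    (1 + x) * gaussPhi α x = gaussJ α x := by
  refine eq_of_powerSum (F := fun x => (1 + x) * gaussPhi α x) (r := 1) (s := 1)
    ((analyticOnNhd_const.add analyticOnNhd_id).mul (analyticOnNhd_gaussPhi h1 h2))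
    (analyticOnNhd_gaussJ h1 h2) one_pos one_pos
    ((powerSum_one_add 1).mul (powerSum_gaussPhi h1 h2)) ?_ hx
  rw [← gaussSeries_J_eq]
  exact powerSum_gaussJ h1 h2

theorem deriv_gaussF (h1 : -1 < α) (h2 : α < 1) {x : ℝ} (hx : -1 < x) :
    deriv (gaussF α) x = α ^ 2 * gaussG α x := by
  obtain ⟨s, hs, h⟩ := (powerSum_gaussF h1 h2).exists_deriv one_pos
  rw [gaussSeries_deriv_F_eq] at h
  exact eq_of_powerSum (G := fun x => α ^ 2 * gaussG α x) (analyticOnNhd_gaussF h1 h2).deriv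
    (analyticOnNhd_const.mul (analyticOnNhd_gaussG h1 h2)) hs one_pos h
    ((powerSum_gaussG h1 h2).const_mul _) hx

theorem gaussF_eq_deriv_gaussG (h1 : -1 < α) (h2 : α < 1) {x : ℝ} (hx : -1 < x) :
    gaussF α x = (1 + x) * (gaussG α x + x * deriv (gaussG α) x) := by
  obtain ⟨s, hs, h⟩ := (powerSum_gaussG h1 h2).exists_deriv one_pos
  refine eq_of_powerSum (G := fun x => (1 + x) * (gaussG α x + x * deriv (gaussG α) x))
    (r := 1) (s := min 1 s)
    (analyticOnNhd_gaussF h1 h2) ((analyticOnNhd_const.add analyticOnNhd_id).mul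
      ((analyticOnNhd_gaussG h1 h2).add (analyticOnNhd_id.mul (analyticOnNhd_gaussG h1 h2).deriv)))
    one_pos (lt_min one_pos hs) (powerSum_gaussF h1 h2) ?_ hx
  rw [gaussSeries_deriv_G_eq]
  exact (powerSum_one_add _).mul (((powerSum_gaussG h1 h2).mono (min_le_left _ _)).add
    ((PowerSum.id _).mul (h.mono (min_le_right _ _))))

theorem hasDerivAt_gaussF (h1 : -1 < α) (h2 : α < 1) {x : ℝ} (hx : -1 < x) :
    HasDerivAt (gaussF α) (α ^ 2 * gaussG α x) x := by
  rw [← deriv_gaussF h1 h2 hx]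
  exact (analyticOnNhd_gaussF h1 h2 x hx).differentiableAt.hasDerivAt

theorem hasDerivAt_mul_gaussG (h1 : -1 < α) (h2 : α < 1) {x : ℝ} (hx : -1 < x) :
    HasDerivAt (fun x => x * gaussG α x) (gaussF α x / (1 + x)) x := by
  have h := (hasDerivAt_id' x).mul (analyticOnNhd_gaussG h1 h2 x hx).differentiableAt.hasDerivAt
  convert! h using 1
  rw [gaussF_eq_deriv_gaussG h1 h2 hx]
  have : 1 + x ≠ 0 := by linarith
  field_simp

theorem one_sub_mul_gaussPhi (h1 : -1 < α) (h2 : α < 1) {x : ℝ} (hx : -1 < x) :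
    (1 - α) * ((1 + x) * gaussPhi α x) = gaussF α x - α * ((1 + x) * gaussG α x) := by
  rw [one_add_mul_gaussPhi h1 h2 hx, gaussF]
  ring

theorem gaussG_zero (h1 : -1 < α) (h2 : α < 1) : gaussG α 0 = 1 := by
  simpa [gaussG, eulerInt] using
    setIntegral_betaPDFReal (b := 1 + α) (d := 1 - α) (by linarith) (by linarith)

theorem gaussPhi_zero (h1 : -1 < α) (h2 : α < 1) : gaussPhi α 0 = 1 := by
  simpa [gaussPhi, eulerInt] using
    setIntegral_betaPDFReal (b := 1 + α) (d := 1 - α) (by linarith) (by linarith)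

theorem gaussJ_zero (h1 : -1 < α) (h2 : α < 1) : gaussJ α 0 = 1 := by
  simpa [gaussJ, eulerInt] using
    setIntegral_betaPDFReal (b := 1 - α) (d := 1 + α) (by linarith) (by linarith)

theorem gaussF_zero (h1 : -1 < α) (h2 : α < 1) : gaussF α 0 = 1 := by
  rw [gaussF, gaussJ_zero h1 h2, gaussG_zero h1 h2]
  ring

theorem gauss2F1_F (h1 : -1 < α) (h2 : α < 1) {x : ℝ} (hx : -1 < x) :
    gauss2F1 α (-α) 1 (-x) = gaussF α x :=
  gauss2F1_neg_eq (analyticOnNhd_gaussF h1 h2) (powerSum_gaussF h1 h2) hx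

theorem gauss2F1_G (h1 : -1 < α) (h2 : α < 1) {x : ℝ} (hx : -1 < x) :
    gauss2F1 (1 + α) (1 - α) 2 (-x) = gaussG α x :=
  gauss2F1_neg_eq (analyticOnNhd_gaussG h1 h2)
    (gaussSeries_symm (1 - α) (1 + α) 2 ▸ powerSum_gaussG h1 h2) hx

theorem gauss2F1_Phi (h1 : -1 < α) (h2 : α < 1) {x : ℝ} (hx : -1 < x) :
    gauss2F1 (1 + α) (2 - α) 2 (-x) = gaussPhi α x :=
  gauss2F1_neg_eq (analyticOnNhd_gaussPhi h1 h2)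
    (gaussSeries_symm (2 - α) (1 + α) 2 ▸ powerSum_gaussPhi h1 h2) hx

theorem gauss2F1_J (h1 : -1 < α) (h2 : α < 1) {x : ℝ} (hx : -1 < x) :
    gauss2F1 α (1 - α) 2 (-x) = gaussJ α x :=
  gauss2F1_neg_eq (analyticOnNhd_gaussJ h1 h2) (powerSum_gaussJ h1 h2) hx

end

/-! ### Growth and decay of Euler integrals. -/

section Bounds

variable {a b d x : ℝ}

theorem eulerInt_nonneg (hb : 0 < b) (hd : 0 < d) (hx : 0 ≤ x) : 0 ≤ eulerInt a b d x := by
  refine setIntegral_nonneg measurableSet_Ioo fun s hs => ?_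
  exact mul_nonneg (betaPDFReal_nonneg hb hd s)
    (Real.rpow_nonneg (one_add_mul_pos (by linarith) (Ioo_subset_Icc_self hs)).le _)

theorem eulerInt_le_of_forall_le (hb : 0 < b) (hd : 0 < d) (hx : 0 ≤ x) {M : ℝ}
    (h : ∀ s ∈ Ioo (0 : ℝ) 1, (1 + x * s) ^ (-a) ≤ M) : eulerInt a b d x ≤ M := by
  have h1 : eulerInt a b d x ≤
      ∫ s in Ioo (0 : ℝ) 1, ProbabilityTheory.betaPDFReal b d s * M := by
    refine setIntegral_mono_on (integrableOn_eulerInt hb hd a (by linarith))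
      ((integrable_betaPDFReal hb hd).integrableOn.mul_const M) measurableSet_Ioo fun s hs => ?_
    exact mul_le_mul_of_nonneg_left (h s hs) (betaPDFReal_nonneg hb hd s)
  rwa [integral_mul_const, setIntegral_betaPDFReal hb hd, one_mul] at h1

theorem eulerInt_le_one (hb : 0 < b) (hd : 0 < d) (ha : 0 ≤ a) (hx : 0 ≤ x) :
    eulerInt a b d x ≤ 1 :=
  eulerInt_le_of_forall_le hb hd hx fun s hs =>
    Real.rpow_le_one_of_one_le_of_nonpos (by nlinarith [mul_nonneg hx hs.1.le]) (by linarith)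

theorem eulerInt_le_sqrt (hb : 0 < b) (hd : 0 < d) (ha : -(1 / 2) ≤ a) (hx : 0 ≤ x) :
    eulerInt a b d x ≤ (1 + x) ^ (1 / 2 : ℝ) :=
  eulerInt_le_of_forall_le hb hd hx fun s hs => by
    have h1 : 1 ≤ 1 + x * s := by nlinarith [mul_nonneg hx hs.1.le]
    calc (1 + x * s) ^ (-a) ≤ (1 + x * s) ^ (1 / 2 : ℝ) :=
          Real.rpow_le_rpow_of_exponent_le h1 (by linarith)
      _ ≤ (1 + x) ^ (1 / 2 : ℝ) := by
          refine Real.rpow_le_rpow (by linarith) ?_ (by norm_num)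
          nlinarith [hs.2]

open ProbabilityTheory in
theorem integrableOn_betaPDFReal_mul_rpow {p : ℝ} (hb : p < b) (hb0 : 0 < b) (hd : 0 < d) :
    IntegrableOn (fun s => betaPDFReal b d s * s ^ (-p)) (Ioo (0 : ℝ) 1) := by
  have h := ((integrable_betaPDFReal (b := b - p) (by linarith) hd).const_mul
    (beta (b - p) d / beta b d)).integrableOn (s := Ioo (0 : ℝ) 1)
  refine h.congr_fun (fun s hs => ?_) measurableSet_Ioo
  have h1 : 0 < s ∧ s < 1 := hs
  have h2 := beta_pos (α := b - p) (by linarith) hd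
  have h3 := beta_pos hb0 hd
  simp only [betaPDFReal, h1, and_self, if_true]
  rw [show b - p - 1 = b - 1 + -p by ring, Real.rpow_add hs.1]
  field_simp

/-- Since 1 + xs ≥ s(1+x) on (0,1), the factor (1+x)^(-p) comes out, at the price of the moment of
s^(-p), finite because p < b. -/
theorem eulerInt_le_rpow (hb : 0 < b) (hd : 0 < d) {p : ℝ} (hp : 0 ≤ p) (hpb : p < b)
    (hpa : p ≤ a) : ∃ C, 0 ≤ C ∧ ∀ x, 0 ≤ x → eulerInt a b d x ≤ C * (1 + x) ^ (-p) := by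
  refine ⟨∫ s in Ioo (0 : ℝ) 1, ProbabilityTheory.betaPDFReal b d s * s ^ (-p), ?_, ?_⟩
  · refine setIntegral_nonneg measurableSet_Ioo fun s hs => ?_
    exact mul_nonneg (betaPDFReal_nonneg hb hd s) (Real.rpow_nonneg hs.1.le _)
  · intro x hx
    rw [← integral_mul_const]
    refine setIntegral_mono_on (integrableOn_eulerInt hb hd a (by linarith))
      ((integrableOn_betaPDFReal_mul_rpow hpb hb hd).mul_const _) measurableSet_Ioo fun s hs => ?_
    rw [mul_assoc]
    refine mul_le_mul_of_nonneg_left ?_ (betaPDFReal_nonneg hb hd s)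
    have h1 : 1 ≤ 1 + x * s := by nlinarith [mul_nonneg hx hs.1.le]
    rw [← Real.mul_rpow hs.1.le (by linarith)]
    calc (1 + x * s) ^ (-a) ≤ (1 + x * s) ^ (-p) :=
          Real.rpow_le_rpow_of_exponent_le h1 (by linarith)
      _ ≤ (s * (1 + x)) ^ (-p) := by
          refine Real.rpow_le_rpow_of_nonpos (mul_pos hs.1 (by linarith)) ?_ (by linarith)
          nlinarith [hs.2]

end Bounds

/-! ### Analyticity of the Stieltjes transform. -/

section Stieltjes

variable {ψ : ℝ → ℝ}

theorem powerSum_stieltjes {x : ℝ} (hx : -1 < x)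
    (hψ : IntegrableOn (fun t => ψ t / (1 + t + x)) (Ioi 0)) :
    PowerSum (PowerSeries.mk fun n => ∫ t in Ioi (0 : ℝ), ψ t / (1 + t + x) *
        (-(1 + t + x)⁻¹) ^ n)
      (fun h => ∫ t in Ioi (0 : ℝ), ψ t / (1 + t + (x + h))) (1 + x) := by
  have h1x : 0 < 1 + x := by linarith
  have hbound : ∀ᵐ t ∂(volume.restrict (Ioi (0 : ℝ))), |(-(1 + t + x)⁻¹)| ≤ (1 + x)⁻¹ := by
    filter_upwards [ae_restrict_mem measurableSet_Ioi] with t ht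
    have ht : 0 < t := ht
    rw [abs_neg, abs_of_pos (by positivity [show 0 < 1 + t + x by linarith])]
    exact inv_anti₀ h1x (by linarith)
  have hmeas : AEStronglyMeasurable (fun t : ℝ => -(1 + t + x)⁻¹)
      (volume.restrict (Ioi (0 : ℝ))) := Measurable.aestronglyMeasurable (by fun_prop)
  have key := powerSum_integral_binomial hψ hmeas (inv_pos.mpr h1x) hbound 1
  rw [inv_inv] at key
  have h1 : ∀ n, negBinomCoeff 1 n = 1 := fun n => by
    rw [negBinomCoeff, ascPochhammer_eval_one, div_self (by positivity)]
  simp only [h1, one_mul] at key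
  refine key.congr fun h hh => ?_
  refine setIntegral_congr_fun measurableSet_Ioi fun t ht => ?_
  have ht : 0 < t := ht
  have h2 : 0 < 1 + t + x := by linarith
  have h3 : 0 < 1 + t + (x + h) := by linarith [(abs_lt.mp hh).1]
  have h4 : 1 - h * (-(1 + t + x)⁻¹) = (1 + t + (x + h)) / (1 + t + x) := by
    field_simp
    ring
  simp only [Real.rpow_neg_one]
  rw [h4]
  field_simp

theorem integrableOn_stieltjes (hψ : IntegrableOn (fun t => ψ t / (1 + t)) (Ioi 0)) {x : ℝ}
    (hx : -1 < x) : IntegrableOn (fun t => ψ t / (1 + t + x)) (Ioi 0) := by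
  have h1x : 0 < 1 + x := by linarith
  have h : IntegrableOn (fun t => ψ t / (1 + t) * ((1 + t) / (1 + t + x))) (Ioi 0) := by
    refine hψ.mul_bdd (c := 1 + (1 + x)⁻¹) (Measurable.aestronglyMeasurable (by fun_prop)) ?_
    filter_upwards [ae_restrict_mem measurableSet_Ioi] with t ht
    have ht : 0 < t := ht
    have h2 : 0 < 1 + t + x := by linarith
    rw [Real.norm_of_nonneg (by positivity), div_le_iff₀ h2, add_mul, inv_mul_eq_div]
    have h3 : 1 ≤ (1 + t + x) / (1 + x) := by rw [le_div_iff₀ h1x]; linarith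
    rcases le_or_gt 0 x with h0 | h0
    · nlinarith
    · have h4 : -x ≤ (1 + t + x) / (1 + x) := by linarith
      linarith
  refine h.congr_fun (fun t ht => ?_) measurableSet_Ioi
  have ht : 0 < t := ht
  have h2 : 0 < 1 + t + x := by linarith
  field_simp

theorem analyticOnNhd_stieltjes (hψ : IntegrableOn (fun t => ψ t / (1 + t)) (Ioi 0)) :
    AnalyticOnNhd ℝ (fun x => ∫ t in Ioi (0 : ℝ), ψ t / (1 + t + x)) (Ioi (-1)) := fun x hx =>
  (powerSum_stieltjes hx (integrableOn_stieltjes hψ hx)).analyticAt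
    (F := fun x => ∫ t in Ioi (0 : ℝ), ψ t / (1 + t + x)) (by have : -1 < x := hx; linarith)

end Stieltjes

/-! ### Decay, differential equation and moments of Φ. -/

section

variable {α : ℝ}

theorem gaussPhi_nonneg (h1 : -1 < α) (h2 : α < 1) {x : ℝ} (hx : 0 ≤ x) : 0 ≤ gaussPhi α x :=
  eulerInt_nonneg (by linarith) (by linarith) hx

/-- An exponent above 1/2 gives square integrability. It exists because 1 + α > 1/2, which is where
λ = -1/π has to be excluded. -/
theorem gaussPhi_le_rpow (h1 : -(1 / 2) < α) (h2 : α ≤ 1 / 2) :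
    ∃ C p : ℝ, 0 ≤ C ∧ 1 / 2 < p ∧ ∀ x, 0 ≤ x → gaussPhi α x ≤ C * (1 + x) ^ (-p) := by
  have hm : 1 / 2 < min 1 (1 + α) := lt_min (by norm_num) (by linarith)
  obtain ⟨p, hp1, hp2⟩ := exists_between hm
  obtain ⟨C, hC, h⟩ := eulerInt_le_rpow (a := 2 - α) (b := 1 + α) (d := 1 - α) (p := p)
    (by linarith) (by linarith) (by linarith) (hp2.trans_le (min_le_right _ _))
    (by linarith [hp2.trans_le (min_le_left _ _)])
  exact ⟨C, p, hC, hp1, h⟩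

theorem continuousOn_gaussPhi (h1 : -1 < α) (h2 : α < 1) : ContinuousOn (gaussPhi α) (Ioi (-1)) :=
  (analyticOnNhd_gaussPhi h1 h2).continuousOn

theorem aestronglyMeasurable_gaussPhi (h1 : -1 < α) (h2 : α < 1) :
    AEStronglyMeasurable (gaussPhi α) (volume.restrict (Ioi 0)) :=
  ((continuousOn_gaussPhi h1 h2).mono (Ioi_subset_Ioi (by norm_num))).aestronglyMeasurable
    measurableSet_Ioi

theorem integrableOn_one_add_rpow {p : ℝ} (hp : 1 < p) :
    IntegrableOn (fun t : ℝ => (1 + t) ^ (-p)) (Ioi 0) := by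
  have := integrableOn_add_rpow_Ioi_of_lt (a := -p) (c := 0) (m := 1) (by linarith) (by norm_num)
  simpa [add_comm] using this

theorem integrableOn_gaussPhi_div (h1 : -(1 / 2) < α) (h2 : α ≤ 1 / 2) :
    IntegrableOn (fun t => gaussPhi α t / (1 + t)) (Ioi 0) := by
  obtain ⟨C, p, hC, hp, h⟩ := gaussPhi_le_rpow h1 h2
  refine Integrable.mono' ((integrableOn_one_add_rpow (p := p + 1) (by linarith)).const_mul C)
    ((aestronglyMeasurable_gaussPhi (by linarith) (by linarith)).aemeasurable.div
      (by fun_prop)).aestronglyMeasurable ?_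
  filter_upwards [ae_restrict_mem measurableSet_Ioi] with t ht
  have ht : 0 < t := ht
  rw [Real.norm_of_nonneg (div_nonneg (gaussPhi_nonneg (by linarith) (by linarith) ht.le)
    (by linarith)), neg_add, Real.rpow_add (by linarith), Real.rpow_neg_one, div_eq_mul_inv,
    ← mul_assoc]
  exact mul_le_mul_of_nonneg_right (h t ht.le) (by positivity)

theorem memLp_gaussPhi (h1 : -(1 / 2) < α) (h2 : α ≤ 1 / 2) :
    MemLp (gaussPhi α) 2 (volume.restrict (Ioi 0)) := by
  obtain ⟨C, p, hC, hp, h⟩ := gaussPhi_le_rpow h1 h2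
  have hm := aestronglyMeasurable_gaussPhi (α := α) (by linarith) (by linarith)
  rw [memLp_two_iff_integrable_sq hm]
  refine Integrable.mono' ((integrableOn_one_add_rpow (p := 2 * p) (by linarith)).const_mul (C ^ 2))
    (hm.pow 2) ?_
  filter_upwards [ae_restrict_mem measurableSet_Ioi] with t ht
  have ht : 0 < t := ht
  have h3 := gaussPhi_nonneg (α := α) (by linarith) (by linarith) ht.le
  rw [Real.norm_of_nonneg (by positivity)]
  calc gaussPhi α t ^ 2 ≤ (C * (1 + t) ^ (-p)) ^ 2 := pow_le_pow_left₀ h3 (h t ht.le) 2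
    _ = C ^ 2 * (1 + t) ^ (-(2 * p)) := by
      rw [mul_pow, ← Real.rpow_natCast ((1 + t) ^ (-p)), ← Real.rpow_mul (by linarith)]
      congr 2
      push_cast; ring

theorem tendsto_one_add_rpow_neg {p : ℝ} (hp : 0 < p) :
    Tendsto (fun t : ℝ => (1 + t) ^ (-p)) atTop (𝓝 0) :=
  (tendsto_rpow_neg_atTop hp).comp (tendsto_atTop_add_const_left atTop 1 tendsto_id)

theorem tendsto_gaussPhi (h1 : -(1 / 2) < α) (h2 : α ≤ 1 / 2) :
    Tendsto (gaussPhi α) atTop (𝓝 0) := by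
  obtain ⟨C, p, hC, hp, h⟩ := gaussPhi_le_rpow h1 h2
  refine squeeze_zero' (g := fun t => C * (1 + t) ^ (-p)) ?_ ?_ ?_
  · filter_upwards [eventually_ge_atTop 0] with t ht
    exact gaussPhi_nonneg (by linarith) (by linarith) ht
  · filter_upwards [eventually_ge_atTop 0] with t ht
    exact h t ht
  · simpa using (tendsto_one_add_rpow_neg (p := p) (by linarith)).const_mul C

/-- The derivative of `x ↦ x (1 + x) ₂F₁(2 - α, 1 + α; 2; -x)`. -/
noncomputable def gaussW (α x : ℝ) : ℝ := gaussF α x - α * (x * gaussG α x)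

theorem hasDerivAt_gaussW (h1 : -1 < α) (h2 : α < 1) {x : ℝ} (hx : -1 < x) :
    HasDerivAt (gaussW α) (-(α * (1 - α)) * gaussPhi α x) x := by
  have h := (hasDerivAt_gaussF h1 h2 hx).sub ((hasDerivAt_mul_gaussG h1 h2 hx).const_mul α)
  convert! h using 1
  have h3 := one_sub_mul_gaussPhi h1 h2 hx
  have h4 : 1 + x ≠ 0 := by linarith
  field_simp
  linear_combination -α * h3

/-- For y = x(1+x)Φ, this and `hasDerivAt_gaussW` say y'' = -α(1-α)Φ, the hypergeometric equation.
-/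
theorem hasDerivAt_mul_gaussPhi (h1 : -1 < α) (h2 : α < 1) {x : ℝ} (hx : -1 < x) :
    HasDerivAt (fun x => x * ((1 + x) * gaussPhi α x)) (gaussW α x) x := by
  have h := (((hasDerivAt_id' x).mul (hasDerivAt_gaussF h1 h2 hx)).sub
    ((((hasDerivAt_id' x).const_add 1).mul (hasDerivAt_mul_gaussG h1 h2 hx)).const_mul α)).const_mul
      (1 - α)⁻¹
  have h4 : 1 + x ≠ 0 := by linarith
  have h5 : 1 - α ≠ 0 := by linarith
  refine HasDerivAt.congr_of_eventuallyEq (f := _) (h.congr_deriv ?_) ?_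
  · rw [gaussW]
    field_simp
    ring
  · filter_upwards [Ioi_mem_nhds hx] with y hy
    simp only [Pi.mul_apply, Pi.sub_apply]
    rw [eq_inv_mul_iff_mul_eq₀ h5]
    linear_combination y * one_sub_mul_gaussPhi h1 h2 hy

/-- In W = (1-α)J + αG the function J is at most √(1+t), as α > -1/2, and G is at most 1. This
removes the boundary term at infinity in `phiMoment_succ`. -/
theorem tendsto_gaussW_div (h1 : -(1 / 2) < α) (h2 : α ≤ 1 / 2) :
    Tendsto (fun t => gaussW α t * (1 + t)⁻¹) atTop (𝓝 0) := by
  have hlim := ((tendsto_one_add_rpow_neg (p := 1 / 2) (by norm_num)).const_mul 2).add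
    (tendsto_one_add_rpow_neg (p := 1) (by norm_num))
  simp only [mul_zero, add_zero] at hlim
  refine squeeze_zero_norm' ?_ hlim
  filter_upwards [eventually_ge_atTop 0] with t ht
  have hW : gaussW α t = (1 - α) * gaussJ α t + α * gaussG α t := by
    rw [gaussW, gaussF]; ring
  have hJ := eulerInt_le_sqrt (a := α) (b := 1 - α) (d := 1 + α) (by linarith) (by linarith)
    h1.le ht
  have hJ0 := eulerInt_nonneg (a := α) (b := 1 - α) (d := 1 + α) (by linarith) (by linarith) ht
  have hG := eulerInt_le_one (a := 1 - α) (b := 1 + α) (d := 1 - α) (by linarith) (by linarith)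
    (by linarith) ht
  have hG0 := eulerInt_nonneg (a := 1 - α) (b := 1 + α) (d := 1 - α) (by linarith) (by linarith) ht
  change gaussJ α t ≤ _ at hJ
  change 0 ≤ gaussJ α t at hJ0
  change gaussG α t ≤ _ at hG
  change 0 ≤ gaussG α t at hG0
  have hWb : |gaussW α t| ≤ 2 * (1 + t) ^ (1 / 2 : ℝ) + 1 := by
    rw [hW]
    refine (abs_add_le _ _).trans (add_le_add ?_ ?_)
    · rw [abs_of_nonneg (mul_nonneg (by linarith) hJ0)]
      exact mul_le_mul (by linarith) hJ hJ0 (by norm_num)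
    · rw [abs_mul, abs_of_nonneg hG0]
      exact mul_le_one₀ (abs_le.mpr ⟨by linarith, by linarith⟩) hG0 hG
  have ht1 : 0 < 1 + t := by linarith
  rw [norm_mul, Real.norm_eq_abs, Real.norm_of_nonneg (by positivity)]
  calc |gaussW α t| * (1 + t)⁻¹ ≤ (2 * (1 + t) ^ (1 / 2 : ℝ) + 1) * (1 + t)⁻¹ := by gcongr
    _ = 2 * (1 + t) ^ (-(1 / 2) : ℝ) + (1 + t) ^ (-1 : ℝ) := by
      rw [add_mul, mul_assoc, ← Real.rpow_neg_one (1 + t), ← Real.rpow_add ht1]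
      norm_num

/-- The moments of `gaussPhi`. -/
noncomputable def phiMoment (α : ℝ) (n : ℕ) : ℝ :=
  ∫ t in Ioi (0 : ℝ), gaussPhi α t * ((1 + t)⁻¹) ^ (n + 1)

theorem inv_one_add_mem {t : ℝ} (ht : 0 < t) : 0 < (1 + t)⁻¹ ∧ (1 + t)⁻¹ < 1 :=
  ⟨by positivity, inv_lt_one_of_one_lt₀ (by linarith)⟩

theorem integrableOn_phiMoment (h1 : -(1 / 2) < α) (h2 : α ≤ 1 / 2) (n : ℕ) :
    IntegrableOn (fun t => gaussPhi α t * ((1 + t)⁻¹) ^ (n + 1)) (Ioi 0) := by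
  have h : IntegrableOn (fun t => gaussPhi α t / (1 + t) * ((1 + t)⁻¹) ^ n) (Ioi 0) := by
    refine (integrableOn_gaussPhi_div h1 h2).mul_bdd (c := 1)
      (Measurable.aestronglyMeasurable (by fun_prop)) ?_
    filter_upwards [ae_restrict_mem measurableSet_Ioi] with t ht
    have := inv_one_add_mem ht
    rw [norm_pow, Real.norm_of_nonneg this.1.le]
    exact pow_le_one₀ this.1.le this.2.le
  refine h.congr_fun (fun t _ => ?_) measurableSet_Ioi
  beta_reduce
  rw [div_eq_mul_inv, mul_assoc, ← pow_succ']

theorem tendsto_phiMoment (h1 : -(1 / 2) < α) (h2 : α ≤ 1 / 2) :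
    Tendsto (phiMoment α) atTop (𝓝 0) := by
  have := tendsto_integral_of_dominated_convergence (μ := volume.restrict (Ioi (0 : ℝ)))
    (F := fun n t => gaussPhi α t * ((1 + t)⁻¹) ^ (n + 1)) (f := fun _ => 0)
    (fun t => gaussPhi α t * ((1 + t)⁻¹) ^ (0 + 1))
    (fun n => (integrableOn_phiMoment h1 h2 n).aestronglyMeasurable)
    (integrableOn_phiMoment h1 h2 0) ?_ ?_
  · rwa [integral_zero] at this
  · intro n
    filter_upwards [ae_restrict_mem measurableSet_Ioi] with t ht
    have h3 := inv_one_add_mem ht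
    have h4 := gaussPhi_nonneg (α := α) (by linarith) (by linarith) (le_of_lt ht)
    rw [Real.norm_of_nonneg (mul_nonneg h4 (pow_nonneg h3.1.le _))]
    exact mul_le_mul_of_nonneg_left (pow_le_pow_of_le_one h3.1.le h3.2.le (by omega)) h4
  · filter_upwards [ae_restrict_mem measurableSet_Ioi] with t ht
    have h3 := inv_one_add_mem ht
    have := ((tendsto_pow_atTop_nhds_zero_of_lt_one h3.1.le h3.2).comp
      (tendsto_add_atTop_nat 1)).const_mul (gaussPhi α t)
    simpa using this

/-- Green's identity for y = t(1+t)Φ and w = (1+t)^(-n-1): integrate y''w - yw'' over (0,∞). The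
boundary term at 0 gives the 1, and (1+α+n)(2-α+n) = (n+1)(n+2) + α(1-α). -/
theorem phiMoment_succ (h1 : -(1 / 2) < α) (h2 : α ≤ 1 / 2) (n : ℕ) :
    phiMoment α (n + 1) * ((n + 1) * (n + 2)) =
      phiMoment α n * ((1 + α + n) * (2 - α + n)) - 1 := by
  have h1' : -1 < α := by linarith
  have h2' : α < 1 := by linarith
  -- This is y'w - yw'. In its derivative, t/(1+t) = 1 - 1/(1+t) splits yw'' into the integrands of
  -- two consecutive moments.
  let H : ℝ → ℝ := fun t => (n + 1) * (t * ((1 + t) * gaussPhi α t)) * ((1 + t)⁻¹) ^ (n + 2) +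
    gaussW α t * ((1 + t)⁻¹) ^ (n + 1)
  let H' : ℝ → ℝ := fun t => -((n + 1) * (n + 2) + α * (1 - α)) *
      (gaussPhi α t * ((1 + t)⁻¹) ^ (n + 1)) +
    (n + 1) * (n + 2) * (gaussPhi α t * ((1 + t)⁻¹) ^ (n + 1 + 1))
  have hd : ∀ t ∈ Ici (0 : ℝ), HasDerivAt H (H' t) t := by
    intro t ht
    have ht : 0 ≤ t := ht
    have ht0 : 1 + t ≠ 0 := by positivity
    have hv : HasDerivAt (fun t : ℝ => (1 + t)⁻¹) (-1 / (1 + t) ^ 2) t :=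
      ((hasDerivAt_id' t).const_add 1).inv ht0
    have h := (((hasDerivAt_mul_gaussPhi h1' h2' (show -1 < t by linarith)).const_mul
      ((n : ℝ) + 1)).mul (hv.pow (n + 2))).add
      ((hasDerivAt_gaussW h1' h2' (show -1 < t by linarith)).mul (hv.pow (n + 1)))
    refine h.congr_deriv ?_
    simp only [H', Nat.add_sub_cancel, Pi.pow_apply, Nat.cast_add, Nat.cast_ofNat, Nat.cast_one]
    have e : -1 / (1 + t) ^ 2 = -((1 + t)⁻¹) ^ 2 := by field_simp
    have e2 : t = ((1 + t)⁻¹)⁻¹ - 1 := by rw [inv_inv]; ring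
    rw [e]
    set v := (1 + t)⁻¹ with hvdef
    have hv0 : v ≠ 0 := inv_ne_zero ht0
    have e3 : (1 + t) = v⁻¹ := by rw [hvdef, inv_inv]
    have e4 : t * v = 1 - v := by
      rw [e2]; field_simp
    rw [e3]
    simp only [pow_succ, show n + 2 - 1 = n + 1 by omega]
    field_simp
    have e5 : t = (1 - v) / v := by field_simp; linarith
    generalize gaussPhi α t = A
    generalize gaussW α t = B
    rw [e5]
    field_simp
    ring
  have hi : IntegrableOn H' (Ioi 0) :=
    ((integrableOn_phiMoment h1 h2 n).const_mul _).add
      ((integrableOn_phiMoment h1 h2 (n + 1)).const_mul _)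
  have hlim : Tendsto H atTop (𝓝 0) := by
    have hb : ∀ k : ℕ, ∀ᶠ t : ℝ in atTop, ‖((1 + t)⁻¹) ^ k‖ ≤ 1 := fun k => by
      filter_upwards [eventually_gt_atTop 0] with t ht
      have := inv_one_add_mem ht
      rw [norm_pow, Real.norm_of_nonneg this.1.le]
      exact pow_le_one₀ this.1.le this.2.le
    have hA : Tendsto (fun t => (n + 1) * gaussPhi α t * ((1 - (1 + t)⁻¹) * ((1 + t)⁻¹) ^ n))
        atTop (𝓝 0) := by
      have h0 : Tendsto (fun t => (n + 1) * gaussPhi α t) atTop (𝓝 0) := by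
        simpa using (tendsto_gaussPhi h1 h2).const_mul ((n : ℝ) + 1)
      refine h0.zero_mul_isBoundedUnder_le ⟨1, ?_⟩
      rw [eventually_map]
      filter_upwards [hb n, eventually_gt_atTop 0] with t ht ht0
      have := inv_one_add_mem ht0
      simp only [Function.comp_apply, norm_mul]
      refine mul_le_one₀ ?_ (norm_nonneg _) ht
      rw [Real.norm_of_nonneg (by linarith)]
      linarith
    have hB : Tendsto (fun t => gaussW α t * (1 + t)⁻¹ * ((1 + t)⁻¹) ^ n) atTop (𝓝 0) := by
      refine (tendsto_gaussW_div h1 h2).zero_mul_isBoundedUnder_le ⟨1, ?_⟩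
      rw [eventually_map]
      exact hb n
    have hAB := hA.add hB
    rw [add_zero] at hAB
    refine hAB.congr' ?_
    filter_upwards [eventually_gt_atTop 0] with t ht
    simp only [H, pow_succ]
    field_simp
    ring
  have key := integral_Ioi_of_hasDerivAt_of_tendsto' hd hi hlim
  have hH0 : H 0 = 1 := by
    simp [H, gaussW, gaussF_zero h1' h2']
  rw [hH0, integral_add ((integrableOn_phiMoment h1 h2 n).const_mul _)
      ((integrableOn_phiMoment h1 h2 (n + 1)).const_mul _), integral_const_mul,
      integral_const_mul] at key
  change -((n + 1) * (n + 2) + α * (1 - α)) * phiMoment α n +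
    (n + 1) * (n + 2) * phiMoment α (n + 1) = 0 - 1 at key
  linear_combination key

end

/-! ### Coefficients of Φ and the integral equation. -/

theorem prod_range_eq_ascPochhammer_eval (a : ℝ) (n : ℕ) :
    ∏ j ∈ Finset.range n, (a + j) = (ascPochhammer ℝ n).eval a := by
  induction n with
  | zero => simp
  | succ n ih => rw [Finset.prod_range_succ, ih, ascPochhammer_succ_eval]

section

variable {α : ℝ}

/-- The limit of the coefficients of `₂F₁(2 - α, 1 + α; 2; z)`. -/
noncomputable def phiLimit (α : ℝ) : ℝ := ((1 - α) * (Real.Gamma (1 + α) * Real.Gamma (1 - α)))⁻¹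

theorem phiLimit_pos (h1 : -1 < α) (h2 : α < 1) : 0 < phiLimit α := by
  have := Real.Gamma_pos_of_pos (show 0 < 1 + α by linarith)
  have := Real.Gamma_pos_of_pos (show 0 < 1 - α by linarith)
  have : 0 < 1 - α := by linarith
  unfold phiLimit
  positivity

/-- Euler's reflection formula; with πα = arcsin(πλ) the right side is λ. -/
theorem phiLimit_mul (h1 : -1 < α) (h2 : α < 1) :
    phiLimit α * (α * (1 - α)) = Real.sin (Real.pi * α) / Real.pi := by
  have h3 : 1 - α ≠ 0 := by linarith
  rcases eq_or_ne α 0 with rfl | h0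
  · simp
  have h := Real.Gamma_mul_Gamma_one_sub α
  have h4 := Real.Gamma_add_one h0
  have h5 := Real.Gamma_pos_of_pos (show 0 < 1 + α by linarith)
  have h6 := Real.Gamma_pos_of_pos (show 0 < 1 - α by linarith)
  rw [add_comm] at h4
  have h7 : Real.Gamma (1 + α) * Real.Gamma (1 - α) =
      α * (Real.pi / Real.sin (Real.pi * α)) := by
    rw [h4, mul_assoc, h]
  have h8 : Real.sin (Real.pi * α) ≠ 0 := by
    intro h8
    rw [h8, div_zero, mul_zero] at h7
    exact (mul_pos h5 h6).ne' h7
  have := Real.pi_ne_zero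
  rw [phiLimit, h7]
  field_simp

/-- Gauss' product formula for Γ at 1 + α and 1 - α: the powers of n in the two products combine to
n², cancelled by the denominators. -/
theorem tendsto_phiCoeff (h1 : -1 < α) (h2 : α < 1) :
    Tendsto (ordinaryHypergeometricCoefficient (2 - α) (1 + α) 2) atTop (𝓝 (phiLimit α)) := by
  have g1 := Real.GammaSeq_tendsto_Gamma (1 + α)
  have g2 := Real.GammaSeq_tendsto_Gamma (1 - α)
  have p1 := Real.Gamma_pos_of_pos (show 0 < 1 + α by linarith)
  have p2 := Real.Gamma_pos_of_pos (show 0 < 1 - α by linarith)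
  have h3 : 0 < 1 - α := by linarith
  have hr : ∀ c : ℝ, Tendsto (fun n : ℕ => (n : ℝ) / (c + n)) atTop (𝓝 1) := fun c => by
    simpa [add_comm] using tendsto_natCast_div_add_atTop (𝕜 := ℝ) c
  have key := ((hr (1 + α)).mul (hr 1)).mul (((g1.mul g2).const_mul (1 - α)).inv₀ (by positivity))
  rw [one_mul, one_mul] at key
  refine key.congr' ?_
  filter_upwards [eventually_gt_atTop 0] with n hn
  have hn : (0 : ℝ) < n := by exact_mod_cast hn
  have q1 : 0 < (ascPochhammer ℝ n).eval (1 + α) := ascPochhammer_pos n _ (by linarith)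
  have q2 : 0 < (ascPochhammer ℝ n).eval (2 - α) := ascPochhammer_pos n _ (by linarith)
  have q3 : (n : ℝ) ^ (1 + α) * (n : ℝ) ^ (1 - α) = n ^ 2 := by
    rw [← Real.rpow_add hn, show 1 + α + (1 - α) = (2 : ℕ) by norm_num, Real.rpow_natCast]
  have q4 : 0 < (n : ℝ) ^ (1 + α) := by positivity
  have q5 : 0 < (n : ℝ) ^ (1 - α) := by positivity
  have q6 : (0 : ℝ) < n.factorial := by positivity
  have q7 : 0 < 1 + α + n := by linarith
  simp only [Real.GammaSeq, prod_range_eq_ascPochhammer_eval, ordinaryHypergeometricCoefficient,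
    ascPochhammer_eval_two]
  rw [ascPochhammer_succ_eval, ascPochhammer_eval_succ_left, show 1 - α + 1 = 2 - α by ring]
  generalize (n : ℝ) ^ (1 + α) = A at *
  generalize (n : ℝ) ^ (1 - α) = B at *
  generalize (ascPochhammer ℝ n).eval (1 + α) = P at *
  generalize (ascPochhammer ℝ n).eval (2 - α) = Q at *
  generalize (n.factorial : ℝ) = N at *
  field_simp
  rw [← q3]
  ring

theorem phiCoeff_succ (n : ℕ) :
    ordinaryHypergeometricCoefficient (2 - α) (1 + α) 2 (n + 1) * ((n + 1) * (n + 2)) =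
      ordinaryHypergeometricCoefficient (2 - α) (1 + α) 2 n * ((1 + α + n) * (2 - α + n)) := by
  have q6 : (0 : ℝ) < n.factorial := by positivity
  simp only [ordinaryHypergeometricCoefficient, ascPochhammer_eval_two, ascPochhammer_succ_eval,
    Nat.factorial_succ]
  push_cast
  field_simp
  ring

/-- The defect e_n = u_n + l m_n - L satisfies the recurrence of u_n, because L α(1-α) = l absorbs
the inhomogeneous term. Hence e_n = e_0 u_n. As e_n → 0 and u_n → L ≠ 0, e_0 = 0. -/
theorem phiCoeff_eq (h1 : -(1 / 2) < α) (h2 : α ≤ 1 / 2) (n : ℕ) :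
    ordinaryHypergeometricCoefficient (2 - α) (1 + α) 2 n =
      phiLimit α - Real.sin (Real.pi * α) / Real.pi * phiMoment α n := by
  have hm := phiLimit_mul (α := α) (by linarith) (by linarith)
  set l := Real.sin (Real.pi * α) / Real.pi with hl
  set u := ordinaryHypergeometricCoefficient (2 - α) (1 + α) 2 with hu
  let e : ℕ → ℝ := fun n => u n + l * phiMoment α n - phiLimit α
  have he : ∀ n, e n = e 0 * u n := by
    intro n
    induction n with
    | zero => simp [hu, ordinaryHypergeometricCoefficient]
    | succ n ih =>
      have r1 := phiCoeff_succ (α := α) n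
      have r2 := phiMoment_succ h1 h2 n
      have h3 : ((n : ℝ) + 1) * (n + 2) ≠ 0 := by positivity
      have h4 : e (n + 1) * ((n + 1) * (n + 2)) = e n * ((1 + α + n) * (2 - α + n)) := by
        simp only [e]
        linear_combination r1 + l * r2 + hm
      refine mul_right_cancel₀ h3 ?_
      rw [h4, ih]
      linear_combination -(e 0) * r1
  have hlim1 : Tendsto e atTop (𝓝 0) := by
    have := ((tendsto_phiCoeff (α := α) (by linarith) (by linarith)).add
      ((tendsto_phiMoment h1 h2).const_mul l)).sub_const (phiLimit α)
    simpa using this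
  have hlim2 : Tendsto e atTop (𝓝 (e 0 * phiLimit α)) := by
    exact ((tendsto_phiCoeff (α := α) (by linarith) (by linarith)).const_mul (e 0)).congr
      fun n => (he n).symm
  have h0 : e 0 = 0 := by
    have := tendsto_nhds_unique hlim1 hlim2
    have hp := phiLimit_pos (α := α) (by linarith) (by linarith)
    rcases mul_eq_zero.mp this.symm with h | h
    · exact h
    · exact absurd h hp.ne'
  have := he n
  rw [h0, zero_mul] at this
  simp only [e] at this
  linarith

theorem gaussPhi_equation (h1 : -(1 / 2) < α) (h2 : α ≤ 1 / 2) {x : ℝ} (hx : -1 < x) :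
    gaussPhi α x = phiLimit α / (1 + x) - Real.sin (Real.pi * α) / Real.pi *
      ∫ t in Ioi (0 : ℝ), gaussPhi α t / (1 + t + x) := by
  have hi := integrableOn_gaussPhi_div h1 h2
  have hS := powerSum_stieltjes (x := 0) (by norm_num) (by simpa using hi)
  -- Multiplication by 1 + x makes the inhomogeneity constant, so that the series with coefficients
  -- (-1)^n L telescopes to L.
  have han : AnalyticOnNhd ℝ (fun x => (1 + x) * (gaussPhi α x + Real.sin (Real.pi * α) / Real.pi *
      ∫ t in Ioi (0 : ℝ), gaussPhi α t / (1 + t + x))) (Ioi (-1)) :=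
    (analyticOnNhd_const.add analyticOnNhd_id).mul
      ((analyticOnNhd_gaussPhi (by linarith) (by linarith)).add
        (analyticOnNhd_const.mul (analyticOnNhd_stieltjes hi)))
  simp only [zero_add, add_zero] at hS
  have hp := (powerSum_one_add 1).mul ((powerSum_gaussPhi (α := α) (by linarith)
    (by linarith)).add (hS.const_mul (Real.sin (Real.pi * α) / Real.pi)))
  have key := eq_of_powerSum han (G := fun _ => phiLimit α) analyticOnNhd_const one_pos one_pos hp
    ?_ hx
  · have h3 : 1 + x ≠ 0 := by linarith
    rw [eq_sub_iff_add_eq, eq_div_iff h3]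
    linear_combination key
  · convert! PowerSum.const (phiLimit α) 1 using 1
    have hc : gaussSeries (2 - α) (1 + α) 2 + PowerSeries.C (Real.sin (Real.pi * α) / Real.pi) *
        (PowerSeries.mk fun n => ∫ t in Ioi (0 : ℝ), gaussPhi α t / (1 + t) *
          (-(1 + t)⁻¹) ^ n) = PowerSeries.mk fun n => (-1) ^ n * phiLimit α := by
      ext n
      have : (∫ t in Ioi (0 : ℝ), gaussPhi α t / (1 + t) * (-(1 + t)⁻¹) ^ n) =
          (-1) ^ n * phiMoment α n := by
        rw [phiMoment, ← integral_const_mul]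
        refine setIntegral_congr_fun measurableSet_Ioi fun t _ => ?_
        rw [neg_pow]
        ring
      rw [map_add, PowerSeries.coeff_C_mul, PowerSeries.coeff_mk, this, gaussSeries,
        PowerSeries.coeff_mk, PowerSeries.coeff_mk, phiCoeff_eq h1 h2 n]
      ring
    rw [hc]
    ext n
    cases n with
    | zero => simp [add_mul]
    | succ n =>
      simp [add_mul, PowerSeries.coeff_succ_X_mul, pow_succ]

end

/-! ### Uniqueness by a weighted Schur test. -/

theorem integrableOn_and_integral_inv_sqrt_mul {b : ℝ} (hb : 0 < b) :
    IntegrableOn (fun t : ℝ => (√t * (b + t))⁻¹) (Ioi 0) ∧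
      ∫ t in Ioi (0 : ℝ), (√t * (b + t))⁻¹ = Real.pi / √b := by
  let g : ℝ → ℝ := fun t => 2 / √b * Real.arctan (√t / √b)
  have hsb : 0 < √b := Real.sqrt_pos.mpr hb
  have hc : ContinuousWithinAt g (Ici 0) 0 := by
    refine Continuous.continuousWithinAt ?_
    exact continuous_const.mul (Real.continuous_arctan.comp
      (Real.continuous_sqrt.div_const _))
  have hd : ∀ t ∈ Ioi (0 : ℝ), HasDerivAt g ((√t * (b + t))⁻¹) t := by
    intro t ht
    have ht : 0 < t := ht
    have h := ((((Real.hasDerivAt_sqrt ht.ne').div_const (√b)).arctan).const_mul (2 / √b))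
    refine h.congr_deriv ?_
    have hst : 0 < √t := Real.sqrt_pos.mpr ht
    rw [div_pow, Real.sq_sqrt ht.le, Real.sq_sqrt hb.le]
    field_simp
    rw [Real.sq_sqrt hb.le]
  have hn : ∀ t ∈ Ioi (0 : ℝ), 0 ≤ (√t * (b + t))⁻¹ := by
    intro t ht
    have ht : 0 < t := ht
    positivity
  have hl : Tendsto g atTop (𝓝 (Real.pi / √b)) := by
    have h1 : Tendsto (fun t : ℝ => √t / √b) atTop atTop :=
      Real.tendsto_sqrt_atTop.atTop_div_const hsb
    have h2 := ((Real.tendsto_arctan_atTop.mono_right nhdsWithin_le_nhds).comp h1).const_mul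
      (2 / √b)
    convert! h2 using 2
    ring
  refine ⟨integrableOn_Ioi_deriv_of_nonneg hc hd hn hl, ?_⟩
  rw [integral_Ioi_of_hasDerivAt_of_nonneg hc hd hn hl]
  simp [g]

theorem lintegral_schur_kernel {x : ℝ} (hx : 0 < x) :
    ∫⁻ t in Ioi (0 : ℝ), ENNReal.ofReal (√x / √t / (1 + t + x)) =
      ENNReal.ofReal (Real.pi * (√x / √(1 + x))) := by
  obtain ⟨h1, h2⟩ := integrableOn_and_integral_inv_sqrt_mul (b := 1 + x) (by linarith)
  have h3 : ∀ t, √x / √t / (1 + t + x) = √x * (√t * (1 + x + t))⁻¹ := fun t => by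
    rw [div_div, div_eq_mul_inv, add_right_comm]
  simp only [h3]
  rw [← ofReal_integral_eq_lintegral_ofReal (h1.const_mul _), integral_const_mul, h2]
  · congr 1; ring
  · filter_upwards [ae_restrict_mem measurableSet_Ioi] with t ht
    have ht : 0 < t := ht
    simp only [Pi.zero_apply]
    positivity

/-- By the arithmetic-geometric mean inequality, 2|ψ(x)ψ(t)| ≤ ψ(x)²√(x/t) + ψ(t)²√(t/x).
Integrating against the kernel gives ∫ψ² ≤ |l|π ∫ψ² √(x/(1+x)). Since |l|π ≤ 1 and √(x/(1+x)) < 1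
pointwise, ψ vanishes almost everywhere. Integrals in [0,∞] avoid any prior integrability of the
double integral. -/
theorem ae_eq_zero_of_stieltjes_eq {l : ℝ} (hl : |l| ≤ 1 / Real.pi) {ψ : ℝ → ℝ}
    (hψ : MemLp ψ 2 (volume.restrict (Ioi 0)))
    (h : ∀ x : ℝ, 0 < x → ψ x = -(l * ∫ t in Ioi (0 : ℝ), ψ t / (1 + t + x))) :
    ψ =ᵐ[volume.restrict (Ioi 0)] 0 := by
  set ν := volume.restrict (Ioi (0 : ℝ)) with hν
  have hm : AEMeasurable ψ ν := hψ.aestronglyMeasurable.aemeasurable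
  let A : ℝ → ℝ → ENNReal := fun x t => ENNReal.ofReal (ψ x ^ 2 * (√x / √t / (1 + t + x)))
  have hA : AEMeasurable (Function.uncurry A) (ν.prod ν) := by
    refine AEMeasurable.ennreal_ofReal ((hm.comp_fst.pow_const 2).mul ?_)
    exact Measurable.aemeasurable (by fun_prop)
  have hAint : ∀ x ∈ Ioi (0 : ℝ), ∫⁻ t, A x t ∂ν =
      ENNReal.ofReal Real.pi * ENNReal.ofReal (ψ x ^ 2 * (√x / √(1 + x))) := by
    intro x hx
    simp only [A]
    simp_rw [ENNReal.ofReal_mul (sq_nonneg (ψ x))]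
    rw [lintegral_const_mul _ (by fun_prop), lintegral_schur_kernel hx,
      ENNReal.ofReal_mul Real.pi_pos.le]
    ring
  have hpt : ∀ x ∈ Ioi (0 : ℝ), 2 * ENNReal.ofReal (ψ x ^ 2) ≤
      ENNReal.ofReal |l| * (∫⁻ t, A x t ∂ν + ∫⁻ t, A t x ∂ν) := by
    intro x hx
    have hx : 0 < x := hx
    have h1 : ENNReal.ofReal |ψ x| ≤
        ENNReal.ofReal |l| * ∫⁻ t, ENNReal.ofReal (|ψ t| / (1 + t + x)) ∂ν := by
      rw [h x hx, abs_neg, abs_mul, ENNReal.ofReal_mul (abs_nonneg _)]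
      gcongr
      rw [← Real.norm_eq_abs, ofReal_norm]
      refine (enorm_integral_le_lintegral_enorm _).trans (lintegral_mono_ae ?_)
      filter_upwards [ae_restrict_mem measurableSet_Ioi] with t ht
      have ht : 0 < t := ht
      rw [← ofReal_norm, Real.norm_eq_abs, abs_div, abs_of_pos (show 0 < 1 + t + x by linarith)]
    calc 2 * ENNReal.ofReal (ψ x ^ 2)
        = 2 * ENNReal.ofReal |ψ x| * ENNReal.ofReal |ψ x| := by
          rw [mul_assoc, ← ENNReal.ofReal_mul (abs_nonneg _), ← sq, sq_abs]
      _ ≤ 2 * ENNReal.ofReal |ψ x| *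
          (ENNReal.ofReal |l| * ∫⁻ t, ENNReal.ofReal (|ψ t| / (1 + t + x)) ∂ν) := by gcongr
      _ = ENNReal.ofReal |l| * ∫⁻ t, 2 * ENNReal.ofReal |ψ x| *
          ENNReal.ofReal (|ψ t| / (1 + t + x)) ∂ν := by
          rw [lintegral_const_mul' _ _ (by finiteness)]
          ring
      _ ≤ ENNReal.ofReal |l| * ∫⁻ t, (A x t + A t x) ∂ν := by
          gcongr 1
          refine lintegral_mono_ae ?_
          filter_upwards [ae_restrict_mem measurableSet_Ioi] with t ht
          have ht : 0 < t := ht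
          have hst : 0 < √t := Real.sqrt_pos.mpr ht
          have hsx : 0 < √x := Real.sqrt_pos.mpr hx
          have hd : 0 < 1 + t + x := by linarith
          simp only [A]
          rw [← ENNReal.ofReal_add (by positivity) (by positivity),
            show (2 : ENNReal) = ENNReal.ofReal 2 by simp, ← ENNReal.ofReal_mul (by norm_num),
            ← ENNReal.ofReal_mul (by positivity)]
          refine ENNReal.ofReal_le_ofReal ?_
          have e0 : ψ x ^ 2 * (√x / √t / (1 + t + x)) + ψ t ^ 2 * (√t / √x / (1 + t + x)) =
              (ψ x ^ 2 * (√x / √t) + ψ t ^ 2 * (√t / √x)) / (1 + t + x) := by ring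
          rw [show 1 + x + t = 1 + t + x by ring, e0, ← mul_div_assoc]
          gcongr
          -- The gap in the mean inequality is a square.
          have e : ψ x ^ 2 * (√x / √t) + ψ t ^ 2 * (√t / √x) - 2 * |ψ x| * |ψ t| =
              (|ψ x| * √x - |ψ t| * √t) ^ 2 / (√x * √t) := by
            rw [← sq_abs (ψ x), ← sq_abs (ψ t)]
            field_simp
            ring
          have : 0 ≤ (|ψ x| * √x - |ψ t| * √t) ^ 2 / (√x * √t) := by positivity
          linarith
      _ = _ := by
          rw [lintegral_add_left']
          refine AEMeasurable.ennreal_ofReal ?_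
          exact Measurable.aemeasurable (by fun_prop)
  let S1 : ℝ → ENNReal := fun x => ENNReal.ofReal (ψ x ^ 2)
  let S2 : ℝ → ENNReal := fun x => ENNReal.ofReal (ψ x ^ 2 * (√x / √(1 + x)))
  have hI : ∫⁻ x, ∫⁻ t, A x t ∂ν ∂ν = ENNReal.ofReal Real.pi * ∫⁻ x, S2 x ∂ν := by
    rw [← lintegral_const_mul' _ _ (by finiteness)]
    exact setLIntegral_congr_fun measurableSet_Ioi hAint
  have hI' : ∫⁻ x, ∫⁻ t, A t x ∂ν ∂ν = ENNReal.ofReal Real.pi * ∫⁻ x, S2 x ∂ν := by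
    rw [← hI]
    exact lintegral_lintegral_swap (f := fun x t => A t x) (by
      have := hA.prod_swap
      exact this)
  have hle : ∫⁻ x, S1 x ∂ν ≤ ∫⁻ x, S2 x ∂ν := by
    have h2 : 2 * ∫⁻ x, S1 x ∂ν ≤ 2 * ∫⁻ x, S2 x ∂ν := by
      calc 2 * ∫⁻ x, S1 x ∂ν = ∫⁻ x, 2 * S1 x ∂ν :=
            (lintegral_const_mul' _ _ (by finiteness)).symm
        _ ≤ ∫⁻ x, ENNReal.ofReal |l| * (∫⁻ t, A x t ∂ν + ∫⁻ t, A t x ∂ν) ∂ν :=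
            setLIntegral_mono_ae' measurableSet_Ioi (ae_of_all _ hpt)
        _ = ENNReal.ofReal |l| * (ENNReal.ofReal Real.pi * ∫⁻ x, S2 x ∂ν +
              ENNReal.ofReal Real.pi * ∫⁻ x, S2 x ∂ν) := by
            rw [lintegral_const_mul' _ _ (by finiteness), lintegral_add_left', hI, hI']
            exact hA.lintegral_prod_right'
        _ = ENNReal.ofReal (|l| * Real.pi) * (2 * ∫⁻ x, S2 x ∂ν) := by
            rw [ENNReal.ofReal_mul (abs_nonneg _)]
            ring
        _ ≤ 1 * (2 * ∫⁻ x, S2 x ∂ν) := by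
            gcongr
            rw [← ENNReal.ofReal_one]
            refine ENNReal.ofReal_le_ofReal ?_
            rwa [le_div_iff₀ Real.pi_pos] at hl
        _ = _ := one_mul _
    exact (ENNReal.mul_le_mul_iff_right (by norm_num) (by finiteness)).mp h2
  have hlt : ∀ x : ℝ, 0 < x → √x / √(1 + x) < 1 := fun x hx => by
    rw [div_lt_one (Real.sqrt_pos.mpr (by linarith))]
    exact Real.sqrt_lt_sqrt hx.le (by linarith)
  have h21 : S2 ≤ᵐ[ν] S1 := by
    filter_upwards [ae_restrict_mem measurableSet_Ioi] with x hx
    exact ENNReal.ofReal_le_ofReal (mul_le_of_le_one_right (sq_nonneg _) (hlt x hx).le)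
  have hfin : ∫⁻ x, S1 x ∂ν ≠ ⊤ := by
    have := ((memLp_two_iff_integrable_sq hψ.aestronglyMeasurable).mp hψ).lintegral_lt_top
    exact this.ne
  have heq := ae_eq_of_ae_le_of_lintegral_le h21
    (ne_top_of_le_ne_top hfin (lintegral_mono_ae h21)) (hm.pow_const 2).ennreal_ofReal hle
  filter_upwards [heq, ae_restrict_mem measurableSet_Ioi] with x hx hx0
  have hx0 : 0 < x := hx0
  simp only [S1, S2] at hx
  rw [ENNReal.ofReal_eq_ofReal_iff (by positivity) (by positivity)] at hx
  have h3 : ψ x ^ 2 * (1 - √x / √(1 + x)) = 0 := by linarith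
  rcases mul_eq_zero.mp h3 with h4 | h4
  · simpa using h4
  · exact absurd h4 (by linarith [hlt x hx0])

/-! ### The parameter α and the constants built from λ. -/

section Alpha

variable {l : ℝ}

theorem abs_mul_pi_le (hl : |l| ≤ 1 / Real.pi) : |l * Real.pi| ≤ 1 := by
  rw [abs_mul, abs_of_pos Real.pi_pos]
  rwa [le_div_iff₀ Real.pi_pos] at hl

theorem alphaOf_le (l : ℝ) : alphaOf l ≤ 1 / 2 := by
  rw [alphaOf, div_le_iff₀ Real.pi_pos]
  linarith [Real.arcsin_le_pi_div_two (l * Real.pi)]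

theorem neg_half_le_alphaOf (l : ℝ) : -(1 / 2) ≤ alphaOf l := by
  rw [alphaOf, le_div_iff₀ Real.pi_pos]
  linarith [Real.neg_pi_div_two_le_arcsin (l * Real.pi)]

theorem neg_half_lt_alphaOf (h : -(1 / Real.pi) < l) : -(1 / 2) < alphaOf l := by
  rw [alphaOf, lt_div_iff₀ Real.pi_pos, show -(1 / 2) * Real.pi = -(Real.pi / 2) by ring,
    Real.neg_pi_div_two_lt_arcsin]
  rw [← neg_div, div_lt_iff₀ Real.pi_pos] at h
  exact h

theorem sin_pi_mul_alphaOf (hl : |l| ≤ 1 / Real.pi) :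
    Real.sin (Real.pi * alphaOf l) / Real.pi = l := by
  have h := abs_le.mp (abs_mul_pi_le hl)
  have := Real.pi_ne_zero
  rw [alphaOf, mul_div_cancel₀ _ this, Real.sin_arcsin h.1 h.2]
  field_simp

theorem alphaOf_ne_zero (hl : |l| ≤ 1 / Real.pi) (h0 : l ≠ 0) : alphaOf l ≠ 0 := by
  intro h
  have := sin_pi_mul_alphaOf hl
  rw [h] at this
  simp at this
  exact h0 this.symm

theorem cOf_eq_phiLimit (hl : |l| ≤ 1 / Real.pi) : cOf l = phiLimit (alphaOf l) := by
  have h1 := neg_half_le_alphaOf l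
  have h2 := alphaOf_le l
  have h := phiLimit_mul (α := alphaOf l) (by linarith) (by linarith)
  rw [sin_pi_mul_alphaOf hl] at h
  unfold cOf
  split_ifs with h0
  · subst h0
    simp [phiLimit, alphaOf]
  · have h3 := alphaOf_ne_zero hl h0
    have h4 : 1 - alphaOf l ≠ 0 := by linarith
    rw [div_eq_iff (mul_ne_zero h3 h4), h]

theorem cOf_mul_arcsinQuot (hl : |l| ≤ 1 / Real.pi) :
    cOf l * arcsinQuot l = (1 - alphaOf l)⁻¹ ∧
      l * cOf l * arcsinQuot l ^ 2 = alphaOf l * (1 - alphaOf l)⁻¹ := by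
  have h4 : 1 - alphaOf l ≠ 0 := by linarith [alphaOf_le l]
  rcases eq_or_ne l 0 with h0 | h0
  · subst h0
    simp [cOf, arcsinQuot, alphaOf]
  · have h3 := alphaOf_ne_zero hl h0
    have h5 : arcsinQuot l = alphaOf l / l := by
      rw [arcsinQuot, if_neg h0, alphaOf, div_div, mul_comm l]
    rw [h5, cOf, if_neg h0]
    constructor <;> field_simp

end Alpha

/-! ### Solutions of the equation for φ. -/

section PhiEquation

variable {l : ℝ}

theorem memLp_inv_one_add_add {x : ℝ} (hx : 0 ≤ x) :
    MemLp (fun t : ℝ => (1 + t + x)⁻¹) 2 (volume.restrict (Ioi 0)) := by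
  have hm : AEStronglyMeasurable (fun t : ℝ => (1 + t + x)⁻¹) (volume.restrict (Ioi 0)) :=
    Measurable.aestronglyMeasurable (by fun_prop)
  rw [memLp_two_iff_integrable_sq hm]
  refine Integrable.mono' (integrableOn_one_add_rpow (p := 2) (by norm_num)) (hm.pow 2) ?_
  filter_upwards [ae_restrict_mem measurableSet_Ioi] with t ht
  have ht : 0 < t := ht
  have h1 : 0 < 1 + t + x := by linarith
  rw [Real.norm_of_nonneg (by positivity), Real.rpow_neg (by linarith), inv_pow]
  refine inv_anti₀ (by positivity) ?_
  rw [show (2 : ℝ) = (2 : ℕ) by norm_num, Real.rpow_natCast]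
  exact pow_le_pow_left₀ (by linarith) (by linarith) 2

theorem integrableOn_div_of_memLp {φ : ℝ → ℝ} (hφ : MemLp φ 2 (volume.restrict (Ioi 0))) {x : ℝ}
    (hx : 0 ≤ x) : IntegrableOn (fun t => φ t / (1 + t + x)) (Ioi 0) :=
  hφ.integrable_mul (memLp_inv_one_add_add hx)

/-- The solution Φ has constant c_λ > 0, so subtracting (c/c_λ)Φ from any solution leaves a
homogeneous one, which is zero. The normalisation at 0 then forces c = c_λ. -/
theorem isPhiSolution_iff (hl : |l| ≤ 1 / Real.pi) (hl' : -(1 / Real.pi) < l) (c : ℝ)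
    (φ : ℝ → ℝ) : IsPhiSolution l c φ ↔
      c = cOf l ∧ φ 0 = 1 ∧ ∀ x : ℝ, 0 < x → φ x = gaussPhi (alphaOf l) x := by
  set α := alphaOf l with hα
  have h1 : -(1 / 2) < α := neg_half_lt_alphaOf hl'
  have h2 : α ≤ 1 / 2 := alphaOf_le l
  have hΦ := memLp_gaussPhi h1 h2
  have hΦ0 := gaussPhi_zero (α := α) (by linarith) (by linarith)
  have hc0 : 0 < cOf l := by
    rw [cOf_eq_phiLimit hl]
    exact phiLimit_pos (by linarith) (by linarith)
  have heq : ∀ x, 0 ≤ x → gaussPhi α x = cOf l / (1 + x) -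
      l * ∫ t in Ioi (0 : ℝ), gaussPhi α t / (1 + t + x) := fun x hx => by
    have := gaussPhi_equation h1 h2 (x := x) (by linarith)
    rwa [hα, sin_pi_mul_alphaOf hl, ← cOf_eq_phiLimit hl] at this
  constructor
  · rintro ⟨hφ, hφ0, hφeq⟩
    set k := c / cOf l with hk
    have hck : c = k * cOf l := by rw [hk, div_mul_cancel₀ _ hc0.ne']
    have hψ : MemLp (fun x => φ x - k * gaussPhi α x) 2 (volume.restrict (Ioi 0)) :=
      hφ.sub (hΦ.const_mul k)
    have hψeq : ∀ x, 0 ≤ x → φ x - k * gaussPhi α x =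
        -(l * ∫ t in Ioi (0 : ℝ), (φ t - k * gaussPhi α t) / (1 + t + x)) := by
      intro x hx
      have hi : ∫ t in Ioi (0 : ℝ), (φ t - k * gaussPhi α t) / (1 + t + x) =
          (∫ t in Ioi (0 : ℝ), φ t / (1 + t + x)) -
            k * ∫ t in Ioi (0 : ℝ), gaussPhi α t / (1 + t + x) := by
        rw [← integral_const_mul, ← integral_sub (integrableOn_div_of_memLp hφ hx)
          ((integrableOn_div_of_memLp hΦ hx).const_mul k)]
        refine integral_congr_ae (ae_of_all _ fun t => ?_)
        ring
      rw [hi, hφeq x hx, heq x hx, hck]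
      ring
    have hae := ae_eq_zero_of_stieltjes_eq hl hψ fun x hx => hψeq x hx.le
    -- The integral sees ψ only up to null sets, so the equation itself upgrades vanishing almost
    -- everywhere to every point.
    have hz : ∀ x, 0 ≤ x → φ x = k * gaussPhi α x := by
      intro x hx
      have h3 := hψeq x hx
      rw [integral_eq_zero_of_ae] at h3
      · linarith
      · filter_upwards [hae] with t ht
        simp only [Pi.zero_apply] at ht ⊢
        rw [ht, zero_div]
    have hk1 : k = 1 := by
      have := hz 0 le_rfl
      rw [hφ0, hΦ0, mul_one] at this
      exact this.symm
    refine ⟨by rw [hck, hk1, one_mul], hφ0, fun x hx => ?_⟩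
    rw [hz x hx.le, hk1, one_mul]
  · rintro ⟨rfl, hφ0, hφ⟩
    have hae : gaussPhi α =ᵐ[volume.restrict (Ioi 0)] φ := by
      filter_upwards [ae_restrict_mem measurableSet_Ioi] with t ht
      exact (hφ t ht).symm
    refine ⟨hΦ.ae_eq hae, hφ0, fun x hx => ?_⟩
    have h3 : φ x = gaussPhi α x := by
      rcases hx.eq_or_lt with rfl | hx
      · rw [hφ0, hΦ0]
      · exact hφ x hx
    rw [h3, heq x hx]
    congr 2
    refine setIntegral_congr_fun measurableSet_Ioi fun t ht => ?_
    rw [hφ t ht]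

end PhiEquation

/-! ### Reduction of the equation for J to that for φ. -/

section Fredholm

variable {l μ : ℝ} {J : ℝ → ℝ}

theorem memLp_comp_mul_left_Ioi {Ψ : ℝ → ℝ} {a : ℝ} (ha : 0 < a) :
    MemLp (fun u => Ψ (a * u)) 2 (volume.restrict (Ioi 0)) ↔
      MemLp Ψ 2 (volume.restrict (Ioi 0)) := by
  have he : MeasurableEmbedding (fun u : ℝ => a * u) :=
    (Homeomorph.mulLeft₀ a ha.ne').measurableEmbedding
  have hpre : (fun u : ℝ => a * u) ⁻¹' (Ioi 0) = Ioi 0 := by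
    ext u
    simp [ha]
  have hmap : (volume.restrict (Ioi (0 : ℝ))).map (fun u : ℝ => a * u) =
      ENNReal.ofReal |a⁻¹| • volume.restrict (Ioi (0 : ℝ)) := by
    rw [← Measure.restrict_smul, ← Real.map_volume_mul_left ha.ne',
      he.restrict_map, hpre]
  have h := he.memLp_map_measure_iff (g := Ψ) (p := 2) (μ := volume.restrict (Ioi (0 : ℝ)))
  rw [hmap] at h
  refine h.symm.trans ⟨fun h3 => ?_, fun h3 => h3.smul_measure (by finiteness)⟩
  refine h3.of_measure_le_smul (c := ENNReal.ofReal a) (by finiteness) ?_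
  rw [smul_smul, ← ENNReal.ofReal_mul ha.le, abs_of_pos (by positivity),
    mul_inv_cancel₀ ha.ne', ENNReal.ofReal_one, one_smul]

/-- The rescaled unknown, normalised to `1` at the origin. -/
noncomputable def rescaled (μ : ℝ) (J : ℝ → ℝ) (u : ℝ) : ℝ :=
  if u = 0 then 1 else J (μ ^ 2 * u) / (μ ^ 2 * u * (1 + u))

theorem memLp_rescaled_iff (hμ : 0 < μ) :
    MemLp (rescaled μ J) 2 (volume.restrict (Ioi 0)) ↔
      MemLp (fun x => J x / (x * (μ ^ 2 + x))) 2 (volume.restrict (Ioi 0)) := by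
  have hm : 0 < μ ^ 2 := by positivity
  rw [← memLp_comp_mul_left_Ioi (Ψ := fun x => J x / (x * (μ ^ 2 + x))) hm]
  have hae : rescaled μ J =ᵐ[volume.restrict (Ioi 0)] fun u =>
      μ ^ 2 * (J (μ ^ 2 * u) / (μ ^ 2 * u * (μ ^ 2 + μ ^ 2 * u))) := by
    filter_upwards [ae_restrict_mem measurableSet_Ioi] with u hu
    have hu : 0 < u := hu
    rw [rescaled, if_neg hu.ne']
    field_simp
  rw [memLp_congr_ae hae]
  refine ⟨fun h => ?_, fun h => h.const_mul _⟩
  have h3 := h.const_mul (μ ^ 2)⁻¹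
  convert! h3 using 2
  field_simp

/-- After t = μ²v this is the partial fraction identity uv/((1+v)(1+v+u)) = (1+u)/(1+v+u) - 1/(1+v).
-/
theorem integral_fredholm_eq (hμ : 0 < μ)
    (hφ : MemLp (rescaled μ J) 2 (volume.restrict (Ioi 0))) {u : ℝ} (hu : 0 ≤ u) :
    μ ^ 2 * u * ∫ t in Ioi (0 : ℝ), J t / ((t + μ ^ 2) ^ 2 * (t + μ ^ 2 + μ ^ 2 * u)) =
      (1 + u) * (∫ t in Ioi (0 : ℝ), rescaled μ J t / (1 + t + u)) -
        ∫ t in Ioi (0 : ℝ), rescaled μ J t / (1 + t + 0) := by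
  have hm : 0 < μ ^ 2 := by positivity
  have h := integral_comp_mul_left_Ioi
    (fun t => J t / ((t + μ ^ 2) ^ 2 * (t + μ ^ 2 + μ ^ 2 * u))) 0 hm
  rw [mul_zero, smul_eq_mul, eq_inv_mul_iff_mul_eq₀ hm.ne'] at h
  rw [← h, ← integral_const_mul, ← integral_const_mul, ← integral_const_mul,
    ← integral_sub ((integrableOn_div_of_memLp hφ hu).const_mul _)
      (integrableOn_div_of_memLp hφ le_rfl)]
  refine setIntegral_congr_fun measurableSet_Ioi fun v hv => ?_
  have hv : 0 < v := hv
  have h1 : 0 < 1 + v + u := by linarith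
  have h2 : μ ^ 2 * v + μ ^ 2 + μ ^ 2 * u = μ ^ 2 * (1 + v + u) := by ring
  have h3 : μ ^ 2 * v + μ ^ 2 = μ ^ 2 * (1 + v) := by ring
  simp only [rescaled, if_neg hv.ne', add_zero]
  rw [h2, h3]
  field_simp
  ring

theorem isFredholmSolution_iff_rescaled (hμ : 0 < μ) :
    IsFredholmSolution l μ J ↔ J 0 = 0 ∧ ∃ c, IsPhiSolution l c (rescaled μ J) := by
  have hm : 0 < μ ^ 2 := by positivity
  have h0 : rescaled μ J 0 = 1 := if_pos rfl
  have hJ : ∀ u, 0 < u → J (μ ^ 2 * u) = μ ^ 2 * u * (1 + u) * rescaled μ J u := fun u hu => by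
    rw [rescaled, if_neg hu.ne']
    field_simp
  constructor
  · rintro ⟨hL, hE⟩
    have hφ := (memLp_rescaled_iff hμ).mpr hL
    refine ⟨by simpa using hE 0 le_rfl,
      -- The constant forced by the equation for φ at u = 0, where φ is 1.
      1 + l * ∫ t in Ioi (0 : ℝ), rescaled μ J t / (1 + t + 0), hφ, h0, fun u hu => ?_⟩
    rcases hu.eq_or_lt with rfl | hu
    · rw [h0]; ring
    · have h3 := hE (μ ^ 2 * u) (by positivity)
      have h4 := integral_fredholm_eq hμ hφ hu.le
      rw [hJ u hu] at h3
      have h5 : 0 < 1 + u := by linarith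
      rw [eq_sub_iff_add_eq, eq_div_iff h5.ne']
      have h6 : μ ^ 2 * u ≠ 0 := by positivity
      refine mul_left_cancel₀ h6 ?_
      linear_combination h3 - l * μ ^ 2 * u * h4
  · rintro ⟨hJ0, c, hφ, -, hE⟩
    refine ⟨(memLp_rescaled_iff hμ).mp hφ, fun x hx => ?_⟩
    rcases hx.eq_or_lt with rfl | hx
    · rw [hJ0]; ring
    · obtain ⟨u, rfl⟩ : ∃ u, x = μ ^ 2 * u := ⟨x / μ ^ 2, by field_simp⟩
      have hu : 0 < u := by
        by_contra! h
        nlinarith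
      have h3 := hE u hu.le
      have h4 := integral_fredholm_eq hμ hφ hu.le
      have hc := hE 0 le_rfl
      rw [h0, add_zero, div_one] at hc
      have h5 : 0 < 1 + u := by linarith
      rw [eq_sub_iff_add_eq, eq_div_iff h5.ne'] at h3
      rw [hJ u hu]
      linear_combination μ ^ 2 * u * h3 + l * μ ^ 2 * u * h4 - μ ^ 2 * u * hc

theorem isFredholmSolution_iff (hl : |l| ≤ 1 / Real.pi) (hl' : -(1 / Real.pi) < l) (hμ : 0 < μ) :
    IsFredholmSolution l μ J ↔
      ∀ x : ℝ, 0 ≤ x → J x = x * gaussJ (alphaOf l) (x / μ ^ 2) := by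
  have hm : 0 < μ ^ 2 := by positivity
  have h1 := neg_half_le_alphaOf l
  have h2 := alphaOf_le l
  have h0 : rescaled μ J 0 = 1 := if_pos rfl
  rw [isFredholmSolution_iff_rescaled hμ]
  simp only [isPhiSolution_iff hl hl', exists_eq_left, h0, true_and]
  have key : ∀ u, 0 < u → (rescaled μ J u = gaussPhi (alphaOf l) u ↔
      J (μ ^ 2 * u) = μ ^ 2 * u * gaussJ (alphaOf l) u) := fun u hu => by
    rw [← one_add_mul_gaussPhi (by linarith) (by linarith) (show -1 < u by linarith), rescaled,
      if_neg hu.ne', div_eq_iff (by positivity)]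
    constructor <;> intro h <;> rw [h] <;> ring
  constructor
  · rintro ⟨hJ0, h⟩ x hx
    rcases hx.eq_or_lt with rfl | hx
    · rw [hJ0]; ring
    · have := (key (x / μ ^ 2) (by positivity)).mp (h _ (by positivity))
      rwa [mul_div_cancel₀ _ hm.ne'] at this
  · intro h
    refine ⟨by simpa using h 0 le_rfl, fun u hu => (key u hu).mpr ?_⟩
    rw [h _ (by positivity), mul_div_cancel_left₀ _ hm.ne']

end Fredholm

/-! ### Estimates for primitives and remainders. -/

section Primitive

theorem uIcc_zero_subset {x : ℝ} (hx : -1 < x) : uIcc 0 x ⊆ Ioi (-1) := fun t ht =>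
  lt_of_lt_of_le (lt_min (by norm_num) hx) ht.1

theorem intervalIntegrable_of_continuousOn_Ioi {u : ℝ → ℝ} (hu : ContinuousOn u (Ioi (-1))) {x : ℝ}
    (hx : -1 < x) : IntervalIntegrable u volume 0 x :=
  (hu.mono (uIcc_zero_subset hx)).intervalIntegrable

theorem hasDerivAt_primitive {u : ℝ → ℝ} (hu : ContinuousOn u (Ioi (-1))) {x : ℝ} (hx : -1 < x) :
    HasDerivAt (fun x => ∫ t in (0 : ℝ)..x, u t) (u x) x :=
  intervalIntegral.integral_hasDerivAt_right (intervalIntegrable_of_continuousOn_Ioi hu hx)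
    (hu.stronglyMeasurableAtFilter isOpen_Ioi x hx) (hu.continuousAt (Ioi_mem_nhds hx))

/-- The point t = 0 is exempt because the integrands k(t)/t take a default value there. -/
theorem abs_primitive_le {u : ℝ → ℝ} {y K : ℝ} {N : ℕ}
    (h : ∀ t ∈ uIcc 0 y, t ≠ 0 → |u t| ≤ K * |t| ^ N) :
    |∫ t in (0 : ℝ)..y, u t| ≤ K / (N + 1) * |y| ^ (N + 1) := by
  have key : ∀ {v : ℝ → ℝ} {z : ℝ}, 0 ≤ z → (∀ t ∈ Ioc 0 z, |v t| ≤ K * |t| ^ N) →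
      |∫ t in (0 : ℝ)..z, v t| ≤ K / (N + 1) * |z| ^ (N + 1) := by
    intro v z hz hv
    have h1 := intervalIntegral.norm_integral_le_of_norm_le (f := v) (g := fun t => K * t ^ N)
      (μ := volume) hz (ae_of_all _ fun t ht => by
        have := hv t ht
        rwa [abs_of_pos ht.1] at this)
      ((continuous_const.mul (continuous_pow N)).intervalIntegrable _ _)
    rw [intervalIntegral.integral_const_mul, integral_pow, Real.norm_eq_abs] at h1
    rw [abs_of_nonneg hz]
    refine h1.trans (le_of_eq ?_)
    rw [zero_pow (by omega), sub_zero]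
    ring
  rcases le_total 0 y with hy | hy
  · refine key hy fun t ht => h t ?_ ht.1.ne'
    rw [uIcc_of_le hy]
    exact ⟨ht.1.le, ht.2⟩
  · have h2 := key (v := fun t => u (-t)) (z := -y) (by linarith) fun t ht => by
      have := h (-t) (by rw [uIcc_of_ge hy]; exact ⟨by linarith [ht.2], by linarith [ht.1]⟩)
        (by simpa using ht.1.ne')
      rwa [abs_neg] at this
    rw [intervalIntegral.integral_comp_neg, neg_neg, neg_zero, intervalIntegral.integral_symm,
      abs_neg, abs_neg] at h2
    exact h2

/-- Each term is a difference of consecutive remainders, so summable remainder bounds give absolute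
convergence, beyond convergence of partial sums. -/
theorem hasSum_of_abs_sub_le {a B : ℕ → ℝ} {s : ℝ}
    (h : ∀ N, |s - ∑ n ∈ Finset.range N, a n| ≤ B N) (hB : Summable B) : HasSum a s := by
  have ha : Summable a := by
    refine Summable.of_norm_bounded (g := fun n => B n + B (n + 1))
      (hB.add ((summable_nat_add_iff 1).mpr hB)) fun n => ?_
    have h1 := h n
    have h2 := h (n + 1)
    rw [Finset.sum_range_succ] at h2
    rw [Real.norm_eq_abs]
    rw [abs_le] at h1 h2 ⊢
    constructor <;> linarith
  rw [ha.hasSum_iff_tendsto_nat, tendsto_iff_norm_sub_tendsto_zero]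
  refine squeeze_zero (fun _ => norm_nonneg _) (fun N => ?_) hB.tendsto_atTop_zero
  rw [norm_sub_rev]
  exact h N

end Primitive

/-! ### The hyperlogarithm series. -/

section Hlog

theorem altWord_zero : altWord 0 = [] := rfl

theorem altWord_succ (n : ℕ) : altWord (n + 1) = 0 :: -1 :: altWord n := by
  simp [altWord, List.replicate_succ]

theorem Hlog_nil (x : ℝ) : Hlog x [] = 1 := by
  rw [Hlog]

theorem Hlog_neg_one_cons (x : ℝ) (w : List ℝ) :
    Hlog x (-1 :: w) = ∫ t in (0 : ℝ)..x, Hlog t w / (1 + t) := by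
  rw [Hlog, if_neg]
  · simp only [sub_neg_eq_add, add_comm]
  · intro h
    have := h (-1) (by simp)
    norm_num at this

theorem Hlog_zero_cons_neg_one_cons (x : ℝ) (w : List ℝ) :
    Hlog x (0 :: -1 :: w) = ∫ t in (0 : ℝ)..x, Hlog t (-1 :: w) / t := by
  rw [Hlog, if_neg]
  · simp only [sub_zero]
  · intro h
    have := h (-1) (by simp)
    norm_num at this

theorem continuousOn_div_one_add {u : ℝ → ℝ} (hu : ContinuousOn u (Ioi (-1))) :
    ContinuousOn (fun t => u t / (1 + t)) (Ioi (-1)) :=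
  hu.div (by fun_prop) fun t ht => by have : -1 < t := ht; linarith

/-- A function `k` vanishing at `0` and differentiable there has a continuous quotient `k t / t`. -/
theorem exists_continuousOn_eq_div {k : ℝ → ℝ} (hk0 : k 0 = 0)
    (hk : DifferentiableOn ℝ k (Ioi (-1))) :
    ∃ q : ℝ → ℝ, ContinuousOn q (Ioi (-1)) ∧ ∀ t, t ≠ 0 → q t = k t / t := by
  have h0 : Ioi (-1 : ℝ) ∈ 𝓝 (0 : ℝ) := Ioi_mem_nhds (by norm_num)
  refine ⟨dslope k 0, (continuousOn_dslope h0).mpr ⟨hk.continuousOn, hk.differentiableAt h0⟩,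
    fun t ht => ?_⟩
  rw [dslope_of_ne _ ht, slope_def_field, hk0, sub_zero, sub_zero]

theorem integral_congr_of_ne_zero {u v : ℝ → ℝ} (h : ∀ t, t ≠ 0 → u t = v t) (x : ℝ) :
    ∫ t in (0 : ℝ)..x, u t = ∫ t in (0 : ℝ)..x, v t := by
  refine intervalIntegral.integral_congr_ae ?_
  filter_upwards [compl_mem_ae_iff.mpr (measure_singleton (0 : ℝ))] with t ht _
  exact h t ht

/-- Words starting with -1 are differentiable and vanish at 0, so dividing by t leaves a removable
singularity and the next letter 0 can be integrated, for negative x too. -/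
theorem Hlog_alt_regular (n : ℕ) :
    ContinuousOn (fun x => Hlog x (altWord n)) (Ioi (-1)) ∧
      DifferentiableOn ℝ (fun x => Hlog x (-1 :: altWord n)) (Ioi (-1)) := by
  have step : ∀ m, ContinuousOn (fun x => Hlog x (altWord m)) (Ioi (-1)) →
      DifferentiableOn ℝ (fun x => Hlog x (-1 :: altWord m)) (Ioi (-1)) := by
    intro m hm x hx
    simp only [Hlog_neg_one_cons]
    exact (hasDerivAt_primitive (continuousOn_div_one_add hm) hx).differentiableAt
      |>.differentiableWithinAt
  induction n with
  | zero =>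
    have : ContinuousOn (fun x => Hlog x (altWord 0)) (Ioi (-1)) := by
      simp only [altWord_zero, Hlog_nil]
      exact continuousOn_const
    exact ⟨this, step 0 this⟩
  | succ n ih =>
    have : ContinuousOn (fun x => Hlog x (altWord (n + 1))) (Ioi (-1)) := by
      obtain ⟨q, hq, hq'⟩ := exists_continuousOn_eq_div (by simp [Hlog_neg_one_cons]) ih.2
      simp only [altWord_succ, Hlog_zero_cons_neg_one_cons]
      intro x hx
      simp only [← integral_congr_of_ne_zero hq']
      exact (hasDerivAt_primitive hq hx).continuousAt.continuousWithinAt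
    exact ⟨this, step _ this⟩

theorem intervalIntegrable_Hlog_div {n : ℕ} {x : ℝ} (hx : -1 < x) :
    IntervalIntegrable (fun t => Hlog t (-1 :: altWord n) / t) volume 0 x := by
  obtain ⟨q, hq, hq'⟩ := exists_continuousOn_eq_div (by simp [Hlog_neg_one_cons])
    (Hlog_alt_regular n).2
  refine (intervalIntegrable_of_continuousOn_Ioi hq hx).congr_ae ?_
  refine ae_restrict_of_ae ?_
  filter_upwards [compl_mem_ae_iff.mpr (measure_singleton (0 : ℝ))] with t ht
  exact hq' t ht

variable {α : ℝ}

/-- The remainder of the hyperlogarithm series for `gaussF`. -/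
noncomputable def remainderF (α : ℝ) (N : ℕ) (x : ℝ) : ℝ :=
  gaussF α x - ∑ n ∈ Finset.range N, Hlog x (altWord n) * α ^ (2 * n)

/-- The remainder of the hyperlogarithm series for `x * gaussG`. -/
noncomputable def remainderG (α : ℝ) (N : ℕ) (x : ℝ) : ℝ :=
  x * gaussG α x - ∑ n ∈ Finset.range N, Hlog x (-1 :: altWord n) * α ^ (2 * n)

theorem remainderG_eq (h1 : -1 < α) (h2 : α < 1) (N : ℕ) {x : ℝ} (hx : -1 < x) :
    remainderG α N x = ∫ t in (0 : ℝ)..x, remainderF α N t / (1 + t) := by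
  have hF : ContinuousOn (fun t => gaussF α t / (1 + t)) (Ioi (-1)) :=
    continuousOn_div_one_add (analyticOnNhd_gaussF h1 h2).continuousOn
  have hG : ∫ t in (0 : ℝ)..x, gaussF α t / (1 + t) = x * gaussG α x := by
    rw [intervalIntegral.integral_eq_sub_of_hasDerivAt
      (fun t ht => hasDerivAt_mul_gaussG h1 h2 (uIcc_zero_subset hx ht))
      (intervalIntegrable_of_continuousOn_Ioi hF hx)]
    ring
  have hi : ∀ n ∈ Finset.range N, IntervalIntegrable
      (fun t => Hlog t (altWord n) / (1 + t) * α ^ (2 * n)) volume 0 x := fun n _ =>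
    (intervalIntegrable_of_continuousOn_Ioi
      (continuousOn_div_one_add (Hlog_alt_regular n).1) hx).mul_const _
  have he : ∀ t, remainderF α N t / (1 + t) = gaussF α t / (1 + t) -
      ∑ n ∈ Finset.range N, Hlog t (altWord n) / (1 + t) * α ^ (2 * n) := fun t => by
    rw [remainderF, sub_div, Finset.sum_div]
    simp only [div_mul_eq_mul_div]
  simp only [he]
  rw [intervalIntegral.integral_sub (intervalIntegrable_of_continuousOn_Ioi hF hx)
    (by simpa only [Finset.sum_fn] using IntervalIntegrable.sum _ hi),
    intervalIntegral.integral_finsetSum hi, hG, remainderG]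
  simp only [intervalIntegral.integral_mul_const, Hlog_neg_one_cons]

/-- The term of the empty word is 1 = F(0), the integration constant; the remaining terms shift by
one pair of letters. -/
theorem remainderF_succ_eq (h1 : -1 < α) (h2 : α < 1) (N : ℕ) {x : ℝ} (hx : -1 < x) :
    remainderF α (N + 1) x = α ^ 2 * ∫ t in (0 : ℝ)..x, remainderG α N t / t := by
  have hG : ContinuousOn (gaussG α) (Ioi (-1)) := (analyticOnNhd_gaussG h1 h2).continuousOn
  have hF : α ^ 2 * ∫ t in (0 : ℝ)..x, gaussG α t = gaussF α x - 1 := by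
    rw [← intervalIntegral.integral_const_mul, intervalIntegral.integral_eq_sub_of_hasDerivAt
      (fun t ht => hasDerivAt_gaussF h1 h2 (uIcc_zero_subset hx ht))
      (intervalIntegrable_of_continuousOn_Ioi (continuousOn_const.mul hG) hx), gaussF_zero h1 h2]
  have hi : ∀ n ∈ Finset.range N, IntervalIntegrable
      (fun t => Hlog t (-1 :: altWord n) / t * α ^ (2 * n)) volume 0 x := fun n _ =>
    (intervalIntegrable_Hlog_div hx).mul_const _
  have he : ∀ t, t ≠ 0 → remainderG α N t / t = gaussG α t -
      ∑ n ∈ Finset.range N, Hlog t (-1 :: altWord n) / t * α ^ (2 * n) := fun t ht => by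
    rw [remainderG, sub_div, Finset.sum_div, mul_div_cancel_left₀ _ ht]
    simp only [div_mul_eq_mul_div]
  rw [integral_congr_of_ne_zero he, intervalIntegral.integral_sub
    (intervalIntegrable_of_continuousOn_Ioi hG hx)
    (by simpa only [Finset.sum_fn] using IntervalIntegrable.sum _ hi),
    intervalIntegral.integral_finsetSum hi, mul_sub, hF, remainderF, Finset.sum_range_succ']
  simp only [intervalIntegral.integral_mul_const, ← Hlog_zero_cons_neg_one_cons, ← altWord_succ]
  rw [altWord_zero, Hlog_nil, Finset.mul_sum, mul_zero, pow_zero, mul_one, add_comm, ← sub_sub]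
  congr 1
  refine Finset.sum_congr rfl fun n _ => ?_
  ring

/-- The remainders obey the same two integral relations as F and xG. Each passage from N to N+1
contributes two factors 1/(N+1), which beats any geometric growth. -/
theorem hasSum_Hlog (h1 : -1 < α) (h2 : α < 1) {x : ℝ} (hx : -1 < x) :
    HasSum (fun n => Hlog x (altWord n) * α ^ (2 * n)) (gaussF α x) ∧
      HasSum (fun n => Hlog x (-1 :: altWord n) * α ^ (2 * n)) (x * gaussG α x) := by
  obtain ⟨C, hC⟩ := isCompact_uIcc.exists_bound_of_continuousOn
    ((analyticOnNhd_gaussF h1 h2).continuousOn.mono (uIcc_zero_subset hx))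
  have hCnn : 0 ≤ C := (norm_nonneg _).trans (hC 0 left_mem_uIcc)
  set M := (min 1 (1 + x))⁻¹ with hM
  have hmin : 0 < min 1 (1 + x) := lt_min one_pos (by linarith)
  have hMpos : 0 < M := inv_pos.mpr hmin
  have hMb : ∀ t ∈ uIcc 0 x, 0 < 1 + t ∧ (1 + t)⁻¹ ≤ M := fun t ht => by
    have h4 : min 1 (1 + x) ≤ 1 + t := by
      have := ht.1
      rcases le_total 0 x with h | h
      · rw [inf_of_le_left h] at this
        exact (min_le_left _ _).trans (by linarith)
      · rw [inf_of_le_right h] at this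
        exact (min_le_right _ _).trans (by linarith)
    exact ⟨hmin.trans_le h4, inv_anti₀ hmin h4⟩
  have hsub : ∀ {y}, y ∈ uIcc 0 x → uIcc 0 y ⊆ uIcc 0 x := fun hy =>
    uIcc_subset_uIcc left_mem_uIcc hy
  -- Here C bounds F, the zeroth remainder, and M bounds 1/(1+t) between 0 and x.
  let K : ℕ → ℝ := fun N => C * (α ^ 2 * M) ^ N / (N.factorial : ℝ) ^ 2
  have hKnn : ∀ N, 0 ≤ K N := fun N => by positivity
  have stepG : ∀ N, (∀ y ∈ uIcc 0 x, |remainderF α N y| ≤ K N * |y| ^ N) →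
      ∀ y ∈ uIcc 0 x, |remainderG α N y| ≤ K N * M / (N + 1) * |y| ^ (N + 1) := by
    intro N hN y hy
    rw [remainderG_eq h1 h2 N (uIcc_zero_subset hx hy)]
    refine abs_primitive_le fun t ht _ => ?_
    have hm := hMb t (hsub hy ht)
    rw [abs_div, abs_of_pos hm.1, div_eq_mul_inv]
    calc |remainderF α N t| * (1 + t)⁻¹ ≤ (K N * |t| ^ N) * M :=
          mul_le_mul (hN t (hsub hy ht)) hm.2 (inv_nonneg.mpr hm.1.le)
            (mul_nonneg (hKnn N) (by positivity))
      _ = K N * M * |t| ^ N := by ring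
  have hF : ∀ N, ∀ y ∈ uIcc 0 x, |remainderF α N y| ≤ K N * |y| ^ N := by
    intro N
    induction N with
    | zero =>
      intro y hy
      simpa [remainderF, K] using hC y hy
    | succ N ih =>
      intro y hy
      rw [remainderF_succ_eq h1 h2 N (uIcc_zero_subset hx hy), abs_mul, abs_of_nonneg (sq_nonneg α)]
      have h3 : |∫ t in (0 : ℝ)..y, remainderG α N t / t| ≤
          K N * M / (N + 1) / (N + 1) * |y| ^ (N + 1) := by
        refine abs_primitive_le fun t ht ht0 => ?_
        rw [abs_div, div_le_iff₀ (abs_pos.mpr ht0), mul_assoc, ← pow_succ]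
        exact stepG N ih t (hsub hy ht)
      calc α ^ 2 * |∫ t in (0 : ℝ)..y, remainderG α N t / t|
          ≤ α ^ 2 * (K N * M / (N + 1) / (N + 1) * |y| ^ (N + 1)) := by gcongr
        _ = K (N + 1) * |y| ^ (N + 1) := by
          simp only [K, Nat.factorial_succ]
          push_cast
          have : (N.factorial : ℝ) ≠ 0 := by positivity
          field_simp
          ring
  have hxm : x ∈ uIcc 0 x := right_mem_uIcc
  have hsum : Summable fun N : ℕ => C * ((α ^ 2 * M * |x|) ^ N / (N.factorial : ℝ)) :=
    (Real.summable_pow_div_factorial _).mul_left C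
  have hbound : ∀ N : ℕ, K N * |x| ^ N ≤ C * ((α ^ 2 * M * |x|) ^ N / (N.factorial : ℝ)) := by
    intro N
    have hf : (1 : ℝ) ≤ N.factorial := by
      exact_mod_cast Nat.one_le_iff_ne_zero.mpr N.factorial_ne_zero
    have h5 : (α ^ 2 * M * |x|) ^ N / (N.factorial : ℝ) ^ 2 ≤
        (α ^ 2 * M * |x|) ^ N / (N.factorial : ℝ) := by
      refine div_le_div_of_nonneg_left (by positivity) (by positivity) ?_
      nlinarith
    calc K N * |x| ^ N = C * ((α ^ 2 * M * |x|) ^ N / (N.factorial : ℝ) ^ 2) := by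
          simp only [K, mul_pow]; ring
      _ ≤ _ := mul_le_mul_of_nonneg_left h5 hCnn
  refine ⟨hasSum_of_abs_sub_le (fun N => (hF N x hxm).trans (hbound N)) hsum,
    hasSum_of_abs_sub_le (B := fun N => M * |x| * (C * ((α ^ 2 * M * |x|) ^ N / (N.factorial : ℝ))))
      (fun N => ?_) (hsum.mul_left _)⟩
  refine (stepG N (hF N) x hxm).trans ?_
  have h6 : K N * M / (N + 1) ≤ K N * M :=
    div_le_self (mul_nonneg (hKnn N) hMpos.le) (by linarith [N.cast_nonneg (α := ℝ)])
  calc K N * M / (N + 1) * |x| ^ (N + 1) ≤ K N * M * |x| ^ (N + 1) := by gcongr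
    _ = M * |x| * (K N * |x| ^ N) := by ring
    _ ≤ _ := mul_le_mul_of_nonneg_left (hbound N) (by positivity)

end Hlog

/-! ### The power series of α in λ. -/

section ArcsinSeries

theorem negBinomCoeff_nonneg {a : ℝ} (ha : 0 < a) (n : ℕ) : 0 ≤ negBinomCoeff a n :=
  div_nonneg (ascPochhammer_pos n a ha).le (by positivity)

/-- In this form the binomial series applies and shows that all Taylor coefficients are nonnegative.
-/
theorem arcsin_eq_mul_integral {x : ℝ} (hx : |x| < 1) :
    Real.arcsin x = x * ∫ s in Ioo (0 : ℝ) 1, 1 * (1 - x ^ 2 * s ^ 2) ^ (-(1 / 2) : ℝ) := by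
  have hpos : ∀ s ∈ Icc (0 : ℝ) 1, |x * s| < 1 := fun s hs => by
    rw [abs_mul, abs_of_nonneg hs.1]
    exact (mul_le_of_le_one_right (abs_nonneg x) hs.2).trans_lt hx
  have hpos' : ∀ s ∈ Icc (0 : ℝ) 1, 0 < 1 - x ^ 2 * s ^ 2 := fun s hs => by
    have := (sq_lt_one_iff_abs_lt_one (x * s)).mpr (hpos s hs)
    rw [mul_pow] at this
    linarith
  have hd : ∀ s ∈ uIcc (0 : ℝ) 1, HasDerivAt (fun s => Real.arcsin (x * s))
      (x * (1 * (1 - x ^ 2 * s ^ 2) ^ (-(1 / 2) : ℝ))) s := by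
    intro s hs
    rw [uIcc_of_le zero_le_one] at hs
    have h := abs_lt.mp (hpos s hs)
    have h1 := (Real.hasDerivAt_arcsin (x := x * s) h.1.ne' h.2.ne).comp s
      ((hasDerivAt_id' s).const_mul x)
    refine h1.congr_deriv ?_
    rw [Real.rpow_neg (hpos' s hs).le, ← Real.sqrt_eq_rpow, mul_pow]
    ring
  have hc : ContinuousOn (fun s : ℝ => x * (1 * (1 - x ^ 2 * s ^ 2) ^ (-(1 / 2) : ℝ)))
      (uIcc 0 1) := by
    rw [uIcc_of_le zero_le_one]
    exact continuousOn_const.mul (continuousOn_const.mul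
      (ContinuousOn.rpow_const (by fun_prop) fun s hs => Or.inl (hpos' s hs).ne'))
  have h := intervalIntegral.integral_eq_sub_of_hasDerivAt hd hc.intervalIntegrable
  rw [mul_one, mul_zero, Real.arcsin_zero, sub_zero, intervalIntegral.integral_const_mul,
    intervalIntegral.integral_of_le zero_le_one, integral_Ioc_eq_integral_Ioo] at h
  exact h.symm

/-- The power series of `arcsin (π l) / π`. -/
noncomputable def alphaSeries : PowerSeries ℝ := PowerSeries.mk fun k =>
  if Odd k then negBinomCoeff (1 / 2) (k / 2) * (∫ s in Ioo (0 : ℝ) 1, 1 * (s ^ 2) ^ (k / 2)) *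
    (Real.pi ^ k / Real.pi) else 0

theorem alphaSeries_coeff_nonneg (k : ℕ) : 0 ≤ alphaSeries.coeff k := by
  rw [alphaSeries, PowerSeries.coeff_mk]
  split_ifs
  · have h1 := negBinomCoeff_nonneg (a := 1 / 2) (by norm_num) (k / 2)
    have h2 : 0 ≤ ∫ s in Ioo (0 : ℝ) 1, 1 * (s ^ 2) ^ (k / 2) :=
      setIntegral_nonneg measurableSet_Ioo fun s _ => by positivity
    have := Real.pi_pos
    positivity
  · exact le_rfl

theorem powerSum_alphaOf : PowerSum alphaSeries alphaOf (1 / Real.pi) := fun l hl => by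
  have hpi := Real.pi_pos
  have hx : |l * Real.pi| < 1 := by
    rw [abs_mul, abs_of_pos hpi]
    rwa [lt_div_iff₀ hpi] at hl
  have hb : ∀ᵐ s ∂(volume.restrict (Ioo (0 : ℝ) 1)), |(s ^ 2)| ≤ (1 : ℝ) := by
    filter_upwards [ae_restrict_mem measurableSet_Ioo] with s hs
    rw [abs_of_nonneg (sq_nonneg s)]
    exact pow_le_one₀ hs.1.le hs.2.le
  have h := powerSum_integral_binomial (μ := volume.restrict (Ioo (0 : ℝ) 1)) (w := fun _ => 1)
    (u := fun s => s ^ 2) (integrable_const 1) (Measurable.aestronglyMeasurable (by fun_prop))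
    one_pos hb (1 / 2) ((l * Real.pi) ^ 2)
    (by rw [inv_one, abs_of_nonneg (sq_nonneg _)]; exact (sq_lt_one_iff_abs_lt_one _).mpr hx)
  have h2 := h.mul_left l
  rw [show alphaOf l = l * ∫ s in Ioo (0 : ℝ) 1, 1 * (1 - (l * Real.pi) ^ 2 * s ^ 2) ^
    (-(1 / 2) : ℝ) by
      rw [alphaOf, arcsin_eq_mul_integral hx]
      field_simp]
  have hinj : Function.Injective fun n : ℕ => 2 * n + 1 := fun a b hab => by
    have : 2 * a + 1 = 2 * b + 1 := hab
    omega
  rw [← hinj.hasSum_iff]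
  · convert! h2 using 1
    funext n
    have e : (2 * n + 1) / 2 = n := by omega
    simp only [Function.comp_apply, alphaSeries, PowerSeries.coeff_mk,
      if_pos (odd_two_mul_add_one n), e]
    rw [pow_succ, pow_succ, mul_div_cancel_right₀ _ hpi.ne', mul_pow, mul_pow]
    simp only [← pow_mul]
    ring
  · intro k hk
    rw [alphaSeries, PowerSeries.coeff_mk, if_neg, zero_mul]
    rintro ⟨m, rfl⟩
    exact hk ⟨m, rfl⟩

theorem alphaSeries_pow_coeff_nonneg (m k : ℕ) : 0 ≤ (alphaSeries ^ m).coeff k := by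
  induction m generalizing k with
  | zero =>
    rw [pow_zero, PowerSeries.coeff_one]
    split_ifs <;> norm_num
  | succ m ih =>
    rw [pow_succ, PowerSeries.coeff_mul]
    exact Finset.sum_nonneg fun p _ => mul_nonneg (ih p.1) (alphaSeries_coeff_nonneg p.2)

theorem alphaSeries_pow_coeff_eq_zero {m k : ℕ} (h : k < m) : (alphaSeries ^ m).coeff k = 0 := by
  have hX : PowerSeries.X ∣ alphaSeries := by
    rw [PowerSeries.X_dvd_iff, ← PowerSeries.coeff_zero_eq_constantCoeff_apply, alphaSeries,
      PowerSeries.coeff_mk, if_neg (by decide)]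
  exact PowerSeries.X_pow_dvd_iff.mp (pow_dvd_pow_of_dvd hX m) k h

end ArcsinSeries

/-- Rearrangement of a sum of power series with nonnegative coefficients. -/
theorem hasSum_rearrange {c : ℕ → ℕ → ℝ} {H A B : ℕ → ℝ} {l S : ℝ} (hc : ∀ m k, 0 ≤ c m k)
    (hc0 : ∀ m k, k < m → c m k = 0) (hA : ∀ m, HasSum (fun k => c m k * |l| ^ k) (A m))
    (hB : ∀ m, HasSum (fun k => c m k * l ^ k) (B m)) (hs : Summable fun m => |H m| * A m)
    (hS : HasSum (fun m => H m * B m) S) :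
    HasSum (fun k => (∑ m ∈ Finset.range (k + 1), c m k * H m) * l ^ k) S := by
  let f : ℕ × ℕ → ℝ := fun p => H p.1 * (c p.1 p.2 * l ^ p.2)
  have hnorm : ∀ p : ℕ × ℕ, ‖f p‖ = |H p.1| * (c p.1 p.2 * |l| ^ p.2) := fun p => by
    simp only [f, norm_mul, norm_pow, Real.norm_eq_abs, abs_of_nonneg (hc _ _)]
  -- Tonelli: since c ≥ 0, the absolute values in row m sum to |H m| A m.
  have hf : Summable f := by
    refine Summable.of_norm ((summable_prod_of_nonneg fun p => norm_nonneg (f p)).mpr ⟨?_, ?_⟩)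
    · intro m
      simp only [hnorm]
      exact ((hA m).mul_left _).summable
    · simp only [hnorm]
      refine hs.congr fun m => ?_
      exact ((hA m).mul_left _).tsum_eq.symm
  have h1 : HasSum f S := by
    have h2 := hf.hasSum.prod_fiberwise fun m => (hB m).mul_left (H m)
    rw [hS.unique h2]
    exact hf.hasSum
  have h3 := (Equiv.prodComm ℕ ℕ).hasSum_iff.mpr h1
  refine h3.prod_fiberwise fun k => ?_
  rw [Finset.sum_mul]
  convert! hasSum_sum_of_ne_finset_zero (s := Finset.range (k + 1))
    (f := fun m => (f ∘ (Equiv.prodComm ℕ ℕ)) (k, m)) ?_ using 1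
  · refine Finset.sum_congr rfl fun m _ => ?_
    simp only [f, Function.comp_apply, Equiv.prodComm_apply, Prod.swap]
    ring
  · intro m hm
    have : k < m := by simpa using hm
    simp [f, hc0 m k this]
  · infer_instance

/-! ### Taylor coefficients of α^n/(1-α) and the expansion of J. -/

section TaylorCoefficients

theorem abs_alphaOf_lt_one (l : ℝ) : |alphaOf l| < 1 :=
  abs_lt.mpr ⟨by linarith [neg_half_le_alphaOf l], by linarith [alphaOf_le l]⟩

theorem alphaOf_nonneg {l : ℝ} (hl : 0 ≤ l) : 0 ≤ alphaOf l :=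
  div_nonneg (Real.arcsin_nonneg.mpr (mul_nonneg hl Real.pi_pos.le)) Real.pi_pos.le

theorem hasSum_ite_pow {a : ℝ} (ha : |a| < 1) (n : ℕ) :
    HasSum (fun m => (if n ≤ m then (1 : ℝ) else 0) * a ^ m) (a ^ n / (1 - a)) := by
  have hinj : Function.Injective fun m : ℕ => m + n := add_left_injective n
  rw [← hinj.hasSum_iff]
  · have h := (hasSum_geometric_of_abs_lt_one ha).mul_left (a ^ n)
    convert! h using 1
    funext m
    simp [pow_add, mul_comm]
  · intro m hm
    rw [if_neg, zero_mul]
    intro h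
    exact hm ⟨m - n, Nat.sub_add_cancel h⟩

/-- The coefficient of `l ^ k` in `α ^ n / (1 - α)`, as a sum of coefficients of powers of `α`. -/
noncomputable def quotCoeff (k n : ℕ) : ℝ :=
  ∑ m ∈ Finset.range (k + 1), (alphaSeries ^ m).coeff k * if n ≤ m then 1 else 0

theorem quotCoeff_nonneg (k n : ℕ) : 0 ≤ quotCoeff k n :=
  Finset.sum_nonneg fun m _ => mul_nonneg (alphaSeries_pow_coeff_nonneg m k)
    (by split_ifs <;> norm_num)

theorem quotCoeff_eq_zero {k n : ℕ} (h : k < n) : quotCoeff k n = 0 :=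
  Finset.sum_eq_zero fun m hm => by
    rw [if_neg (by have := Finset.mem_range.mp hm; omega), mul_zero]

/-- Expand α^n/(1-α) as the sum of α^m over m ≥ n and rearrange by powers of l; the majorant is the
same series at α(|l|) < 1. -/
theorem powerSum_quotCoeff (n : ℕ) :
    PowerSum (PowerSeries.mk fun k => quotCoeff k n)
      (fun l => alphaOf l ^ n / (1 - alphaOf l)) (1 / Real.pi) := fun l hl => by
  simp only [PowerSeries.coeff_mk, quotCoeff]
  refine hasSum_rearrange (A := fun m => alphaOf |l| ^ m) (B := fun m => alphaOf l ^ m)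
    alphaSeries_pow_coeff_nonneg (fun m k h => alphaSeries_pow_coeff_eq_zero h)
    (fun m => powerSum_alphaOf.pow m |l| (by rwa [abs_abs]))
    (fun m => powerSum_alphaOf.pow m l hl) ?_ (hasSum_ite_pow (abs_alphaOf_lt_one l) n)
  refine (hasSum_ite_pow (abs_alphaOf_lt_one |l|) n).summable.congr fun m => ?_
  split_ifs <;> simp

theorem alphaTaylor_eq (k n : ℕ) : alphaTaylor k n = quotCoeff k n := by
  have := (powerSum_quotCoeff n).coeff_eq (by have := Real.pi_pos; positivity) k
  rw [PowerSeries.coeff_mk] at this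
  exact this.symm

/-- Even and odd n collect the two parts of (1-α)J = F - α(1+u)G; writing G as (uG)/u explains the
factor (1+u)/u. -/
theorem hasSum_letterTerm {α : ℝ} (h1 : -1 < α) (h2 : α < 1) {u : ℝ} (hu : 0 < u) :
    HasSum (fun n => letterTerm u n * (α ^ n / (1 - α))) (gaussJ α u) := by
  obtain ⟨hF, hG⟩ := hasSum_Hlog h1 h2 (show -1 < u by linarith)
  have h3 : 1 - α ≠ 0 := by linarith
  have h := HasSum.even_add_odd (f := fun n => letterTerm u n * (α ^ n / (1 - α)))
    (m := gaussF α u * (1 - α)⁻¹) (m' := u * gaussG α u * (-((1 + u) / u) * α * (1 - α)⁻¹)) ?_ ?_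
  · convert! h using 1
    have h4 := one_sub_mul_gaussPhi h1 h2 (show -1 < u by linarith)
    rw [← one_add_mul_gaussPhi h1 h2 (show -1 < u by linarith)]
    refine mul_left_cancel₀ h3 ?_
    rw [h4]
    field_simp
    ring
  · convert! hF.mul_right (1 - α)⁻¹ using 1
    funext n
    rw [letterTerm, if_pos (even_two_mul n), Nat.mul_div_cancel_left n two_pos]
    ring
  · convert! hG.mul_right (-((1 + u) / u) * α * (1 - α)⁻¹) using 1
    funext n
    rw [letterTerm, if_neg (by simp), show (2 * n + 1) / 2 = n by omega]
    ring

/-- A second rearrangement, now weighted by the hyperlogarithms. Its absolute convergence is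
`hasSum_letterTerm` at α(|l|). -/
theorem hasSum_JCoeff {l μ x : ℝ} (hl : |l| < 1 / Real.pi) (hμ : 0 < μ) (hx : 0 < x) :
    HasSum (fun k => JCoeff μ x k * l ^ k) (x * gaussJ (alphaOf l) (x / μ ^ 2)) := by
  have hu : 0 < x / μ ^ 2 := by positivity
  have hα := abs_lt.mp (abs_alphaOf_lt_one l)
  have hα' := abs_lt.mp (abs_alphaOf_lt_one |l|)
  have h := hasSum_rearrange (c := fun n k => quotCoeff k n) (H := letterTerm (x / μ ^ 2))
    (A := fun n => alphaOf |l| ^ n / (1 - alphaOf |l|))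
    (B := fun n => alphaOf l ^ n / (1 - alphaOf l)) (fun m k => quotCoeff_nonneg k m)
    (fun m k h => quotCoeff_eq_zero h)
    (fun n => by simpa using powerSum_quotCoeff n |l| (by rwa [abs_abs]))
    (fun n => by simpa using powerSum_quotCoeff n l hl) ?_ (hasSum_letterTerm hα.1 hα.2 hu)
  · convert! h.mul_left x using 1
    funext k
    simp only [JCoeff, alphaTaylor_eq]
    ring
  · refine (hasSum_letterTerm hα'.1 hα'.2 hu).summable.abs.congr fun n => ?_
    rw [abs_mul, abs_of_nonneg (div_nonneg (pow_nonneg (alphaOf_nonneg (abs_nonneg l)) n)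
      (by linarith [hα'.2]))]

end TaylorCoefficients

/-! ### Assembly of the main theorem. -/

theorem phiHlog_eq_gaussPhi {l : ℝ} (hl : |l| ≤ 1 / Real.pi) {x : ℝ} (hx : 0 < x) :
    phiHlog l x = gaussPhi (alphaOf l) x := by
  have hα := abs_lt.mp (abs_alphaOf_lt_one l)
  obtain ⟨hF, hG⟩ := hasSum_Hlog hα.1 hα.2 (show -1 < x by linarith)
  obtain ⟨h1, h2⟩ := cOf_mul_arcsinQuot hl
  have h3 := one_sub_mul_gaussPhi hα.1 hα.2 (show -1 < x by linarith)
  have h4 : 1 - alphaOf l ≠ 0 := by linarith [hα.2]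
  rw [phiHlog, fHlog, gHlog, hF.tsum_eq, hG.tsum_eq, h1, h2]
  refine mul_left_cancel₀ (mul_ne_zero h4 (show 1 + x ≠ 0 by linarith)) ?_
  rw [mul_assoc (1 - alphaOf l), mul_assoc (1 - alphaOf l), h3]
  field_simp

theorem mainTheorem5 (l : ℝ) (hl : |l| ≤ 1 / Real.pi) :
    -- the two hyperlogarithm series
    (∀ x : ℝ, -1 < x →
      Summable (fun n : ℕ => Hlog x (altWord n) * alphaOf l ^ (2 * n)) ∧
      Summable (fun n : ℕ => Hlog x (-1 :: altWord n) * alphaOf l ^ (2 * n)) ∧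
      fHlog l x = gauss2F1 (alphaOf l) (-alphaOf l) 1 (-x) ∧
      gHlog l x = x * gauss2F1 (1 + alphaOf l) (1 - alphaOf l) 2 (-x)) ∧
    (-(1 / Real.pi) < l →
      -- the combination of `f` and `g` is the unique solution of the equation for `φ`
      (∀ (c : ℝ) (φ : ℝ → ℝ), IsPhiSolution l c φ ↔
        c = cOf l ∧ φ 0 = 1 ∧ ∀ x : ℝ, 0 < x → φ x = phiHlog l x) ∧
      (∀ x : ℝ, 0 < x →
        phiHlog l x = gauss2F1 (1 + alphaOf l) (2 - alphaOf l) 2 (-x)) ∧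
      -- the solution of the original Fredholm equation
      (∀ μ : ℝ, 0 < μ →
        (∀ J : ℝ → ℝ, IsFredholmSolution l μ J ↔
          ∀ x : ℝ, 0 ≤ x →
            J x = x * gauss2F1 (alphaOf l) (1 - alphaOf l) 2 (-(x / μ ^ 2))) ∧
        (∀ x : ℝ, 0 < x →
          x * gauss2F1 (alphaOf l) (1 - alphaOf l) 2 (-(x / μ ^ 2)) =
            x * (1 + x / μ ^ 2) * phiHlog l (x / μ ^ 2)))) ∧
    -- its power series in the coupling constant, to all orders
    (|l| < 1 / Real.pi → ∀ μ : ℝ, 0 < μ → ∀ x : ℝ, 0 < x →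
      HasSum (fun k : ℕ => JCoeff μ x k * l ^ k)
        (x * gauss2F1 (alphaOf l) (1 - alphaOf l) 2 (-(x / μ ^ 2)))) := by
  have hα := abs_lt.mp (abs_alphaOf_lt_one l)
  refine ⟨fun x hx => ?_, fun hl' => ⟨fun c φ => ?_, fun x hx => ?_, fun μ hμ => ⟨fun J => ?_,
    fun x hx => ?_⟩⟩, fun hl' μ hμ x hx => ?_⟩
  · obtain ⟨hF, hG⟩ := hasSum_Hlog hα.1 hα.2 hx
    refine ⟨hF.summable, hG.summable, ?_, ?_⟩
    · rw [gauss2F1_F hα.1 hα.2 hx]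
      exact hF.tsum_eq
    · rw [gauss2F1_G hα.1 hα.2 hx]
      exact hG.tsum_eq
  · rw [isPhiSolution_iff hl hl']
    refine and_congr_right fun _ => and_congr_right fun _ => forall₂_congr fun x hx => ?_
    rw [phiHlog_eq_gaussPhi hl hx]
  · rw [phiHlog_eq_gaussPhi hl hx, gauss2F1_Phi hα.1 hα.2 (by linarith)]
  · rw [isFredholmSolution_iff hl hl' hμ]
    refine forall₂_congr fun x hx => ?_
    rw [gauss2F1_J hα.1 hα.2 (by have : 0 ≤ x / μ ^ 2 := by positivity
                                 linarith)]
  · have hu : 0 < x / μ ^ 2 := by positivity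
    rw [gauss2F1_J hα.1 hα.2 (by linarith), phiHlog_eq_gaussPhi hl hu, mul_assoc,
      one_add_mul_gaussPhi hα.1 hα.2 (by linarith)]
  · have hu : 0 < x / μ ^ 2 := by positivity
    rw [gauss2F1_J hα.1 hα.2 (by linarith)]
    exact hasSum_JCoeff hl' hμ hx
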